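/- Let $\mathbb N=\{0,1,2,\dots\}$ and let $P$ be the set of partitions $\lambda=(\lambda_1\ge\lambda_2\ge\cdots)$, $\lambda_i\in\mathbb N$, $\lambda_i=0$ for large $i$. Let $(m_\lambda)_{\lambda\in P}$ and $(s_\lambda)_{\lambda\in P}$ be the monomial and the Schur symmetric functions in countably many variables, and let $\Lambda_{\mathbb N}=\bigoplus_{\lambda\in P}\mathbb N\,m_\lambda$ and $\Lambda^{\mathrm{Sch}}=\bigoplus_{\lambda\in P}\mathbb N\,s_\lambda$; both are subsemirings of the ring of symmetric functions over $\mathbb Z$. For a commutative semiring $A$ put $W(A)=\mathrm{Hom}_{\mathrm{semiring}}(\Lambda_{\mathbb N},A)$ and $W^{\mathrm{Sch}}(A)=\mathrm{Hom}_{\mathrm{semiring}}(\Lambda^{\mathrm{Sch}},A)$. Let $A$ be a zerosumfree domain, that is, a nonzero commutative semiring in which $x+y=0$ implies $x=y=0$, and $xy=0$ implies $x=0$ or $y=0$. (1) Let $a\in W(A)$ be such that $a(m_\lambda)=0$ for some $\lambda\in P$. Then there is a unique pair $(x,y)\in\mathbb N^2$ such that, for all $\lambda\in P$, $a(m_\lambda)=0$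 if and only if $\lambda_{x+1}\ge y+1$. (2) Let $a\in W^{\mathrm{Sch}}(A)$ be such that $a(s_\lambda)=0$ for some $\lambda\in P$. Then there is a unique pair $(x,y)\in\mathbb N^2$ such that, for all $\lambda\in P$, $a(s_\lambda)=0$ if and only if $\lambda_{x+1}\ge y+1$. -/

import Mathlib

noncomputable section

namespace SymmetricFunctions

/-- Partitions, as Young diagrams.  The part `λ_{i+1}` of `μ` is `μ.rowLen i`. -/
abbrev Partition : Type := YoungDiagram

/-- Formal power series over `ℤ` in countably many variables `x_0, x_1, …`, the ambient ring of
the ring of symmetric functions. -/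
abbrev Series : Type := MvPowerSeries ℕ ℤ

open Classical in
/-- The monomial symmetric function `m_μ`: the sum of all distinct monomials whose exponent
sequence is a rearrangement of `(μ_1, μ_2, …)`. -/
def monomialSymm (μ : Partition) : Series :=
  fun d => if ∃ σ : Equiv.Perm ℕ, ∀ i, d (σ i) = μ.rowLen i then 1 else 0

/-- Semistandard tableaux `T` of shape `μ` and weight `d`: the entry `k` occurs `d k` times. -/
def TableauOfWeight (μ : Partition) (d : ℕ →₀ ℕ) : Type :=
  {T : SemistandardYoungTableau μ // ∀ k, (μ.cells.filter fun c => T c.1 c.2 = k).card = d k}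

/-- There are only finitely many tableaux of given shape and weight, so that the cardinality
in the definition of `schur` is a genuine count. -/
instance TableauOfWeight.finite (μ : Partition) (d : ℕ →₀ ℕ) : Finite (TableauOfWeight μ d) := by
  have key : ∀ (T : TableauOfWeight μ d) (c : μ.cells), T.1 c.1.1 c.1.2 ∈ d.support := by
    intro T c
    rw [Finsupp.mem_support_iff, ← T.2, Finset.card_ne_zero]
    exact ⟨c.1, Finset.mem_filter.2 ⟨c.2, rfl⟩⟩
  refine Finite.of_injective
    (fun T : TableauOfWeight μ d => fun c : μ.cells => (⟨_, key T c⟩ : d.support)) ?_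
  intro T T' h
  apply Subtype.ext
  ext i j
  by_cases hc : (i, j) ∈ μ
  · exact congrArg Subtype.val (congrFun h ⟨(i, j), hc⟩)
  · rw [T.1.zeros hc, T'.1.zeros hc]

/-- The Schur symmetric function `s_μ`: the sum of `x^T` over all semistandard tableaux `T` of
shape `μ`, where `x^T` is the product of the `x_k` over the entries `k` of `T`. -/
def schur (μ : Partition) : Series :=
  fun d => (Nat.card (TableauOfWeight μ d) : ℤ)

/-- The semiring `Λ_ℕ = ⨁ ℕ m_μ`.  The `ℕ`-span of the `m_μ` contains `m_∅ = 1` and is closed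
under products, so it is the subsemiring generated by the `m_μ`. -/
def LambdaNat : Subsemiring Series :=
  Subsemiring.closure (Set.range monomialSymm)

/-- The semiring `Λ^Sch = ⨁ ℕ s_μ`.  The `ℕ`-span of the `s_μ` contains `s_∅ = 1` and is closed
under products, so it is the subsemiring generated by the `s_μ`. -/
def LambdaSch : Subsemiring Series :=
  Subsemiring.closure (Set.range schur)

/-- The monomial symmetric function `m_μ` as an element of `Λ_ℕ`. -/
def LambdaNat.m (μ : Partition) : LambdaNat :=
  ⟨monomialSymm μ, Subsemiring.subset_closure ⟨μ, rfl⟩⟩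

/-- The Schur symmetric function `s_μ` as an element of `Λ^Sch`. -/
def LambdaSch.s (μ : Partition) : LambdaSch :=
  ⟨schur μ, Subsemiring.subset_closure ⟨μ, rfl⟩⟩

/-- Big Witt vectors `W(A)`: semiring homomorphisms `Λ_ℕ → A`. -/
abbrev BigWitt (A : Type*) [CommSemiring A] : Type _ := LambdaNat →+* A

/-- Schur Witt vectors `W^Sch(A)`: semiring homomorphisms `Λ^Sch → A`. -/
abbrev SchurWitt (A : Type*) [CommSemiring A] : Type _ := LambdaSch →+* A

/-- A zerosumfree domain: a nonzero commutative semiring in which `x + y = 0` implies `x = y = 0`,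
and `x * y = 0` implies `x = 0` or `y = 0`. -/
structure IsZerosumfreeDomain (A : Type*) [CommSemiring A] : Prop where
  nontrivial : Nontrivial A
  eq_zero_of_add : ∀ x y : A, x + y = 0 → x = 0 ∧ y = 0
  eq_zero_of_mul : ∀ x y : A, x * y = 0 → x = 0 ∨ y = 0

end SymmetricFunctions

end

/-! In a zerosumfree domain a finite sum is nonzero exactly when some term is, and a product exactly
when both factors are. Both bases multiply with coefficients in ℕ, so `a` is nonzero at `μ` and at
`ν` if and only if it is nonzero at some constituent of their product. Only the supports of the
structure constants matter.

The combinatorial core is `existsUnique_rect`. Let x + 1 be the least height of a rectangle at which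
`a` vanishes, and y + 1 the least width for that height. Nonvanishing passes to smaller partitions,
so `a` vanishes at everything containing the (x+1) × (y+1) rectangle. Any other partition lies in a
fat hook (n^x, y^k) with n > y, so it suffices that `a` is nonzero at these. Induct on k: multiply
the hook by the rectangle (y^(x+1)). A constituent at which `a` is nonzero cannot contain the
forbidden rectangle, and this forces it to contain (n^x, y^(k+1)).

For monomial functions the last claim is a pigeonhole argument on exponents. For Schur functions it
uses the Littlewood–Richardson rule `schur_mul`, obtained by Stembridge's argument: multiply an
alternant by a Schur polynomial and cancel the tableaux violating the lattice condition, using a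
Bender–Knuth involution on the columns left of the violation. `IsGood.le_weight` then shows that the
surviving tableaux put a row of length at least y below the hook. -/

noncomputable section

/-! ### Partitions, fat hooks and the rectangle criterion. -/

namespace SymmetricFunctions

/-- The partition with prescribed antitone, finitely supported sequence of parts. -/
def ofParts (f : ℕ → ℕ) (hf : Antitone f) (N : ℕ) (_hN : f N = 0) : Partition where
  cells := (Finset.range N ×ˢ Finset.range (f 0)).filter fun c => c.2 < f c.1
  isLowerSet := by
    rintro ⟨i, j⟩ ⟨i', j'⟩ h hc
    have h1 : i' ≤ i := h.1
    have h2 : j' ≤ j := h.2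
    simp only [Finset.coe_filter, Finset.mem_product, Finset.mem_range, Set.mem_ofPred_eq] at hc ⊢
    have h3 := hf h1
    omega

theorem rowLen_ofParts (f : ℕ → ℕ) (hf : Antitone f) (N : ℕ) (hN : f N = 0) (i : ℕ) :
    (ofParts f hf N hN).rowLen i = f i := by
  have h (j : ℕ) : j < (ofParts f hf N hN).rowLen i ↔ j < f i := by
    rw [← YoungDiagram.mem_iff_lt_rowLen, ← YoungDiagram.mem_cells]
    simp only [ofParts, Finset.mem_filter, Finset.mem_product, Finset.mem_range]
    refine ⟨fun h => h.2, fun h => ⟨⟨?_, h.trans_le (hf (Nat.zero_le i))⟩, h⟩⟩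
    by_contra! hi
    have := hf hi
    omega
  apply le_antisymm
  · by_contra! h'
    exact lt_irrefl _ ((h _).1 h')
  · by_contra! h'
    exact lt_irrefl _ ((h _).2 h')

theorem le_iff_rowLen {μ ν : Partition} : μ ≤ ν ↔ ∀ i, μ.rowLen i ≤ ν.rowLen i := by
  constructor
  · intro h i
    by_contra! h'
    have : (i, ν.rowLen i) ∈ ν := h (YoungDiagram.mem_iff_lt_rowLen.2 h')
    exact lt_irrefl _ (YoungDiagram.mem_iff_lt_rowLen.1 this)
  · rintro h ⟨i, j⟩ hc
    exact YoungDiagram.mem_iff_lt_rowLen.2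
      ((YoungDiagram.mem_iff_lt_rowLen.1 hc).trans_le (h i))

theorem rowLen_injective {μ ν : Partition} (h : ∀ i, μ.rowLen i = ν.rowLen i) : μ = ν :=
  le_antisymm (le_iff_rowLen.2 fun i => (h i).le) (le_iff_rowLen.2 fun i => (h i).ge)

@[simp]
theorem rowLen_bot (i : ℕ) : (⊥ : Partition).rowLen i = 0 := by
  by_contra h
  exact YoungDiagram.notMem_bot _ (YoungDiagram.mem_iff_lt_rowLen.2 (Nat.pos_of_ne_zero h))

theorem rowLen_colLen_zero (μ : Partition) {i : ℕ} (hi : μ.colLen 0 ≤ i) : μ.rowLen i = 0 := by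
  by_contra h
  exact absurd (YoungDiagram.mem_iff_lt_colLen.1
    (YoungDiagram.mem_iff_lt_rowLen.2 (Nat.pos_of_ne_zero h))) hi.not_gt

theorem lt_colLen_zero (μ : Partition) {i : ℕ} (hi : μ.rowLen i ≠ 0) : i < μ.colLen 0 := by
  by_contra! h
  exact hi (rowLen_colLen_zero μ h)

/-- The parts of a partition, as a finitely supported sequence. -/
def parts (μ : Partition) : ℕ →₀ ℕ :=
  Finsupp.onFinset (Finset.range (μ.colLen 0)) μ.rowLen fun _ h =>
    Finset.mem_range.2 (lt_colLen_zero μ h)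

@[simp]
theorem parts_apply (μ : Partition) (i : ℕ) : parts μ i = μ.rowLen i := rfl

/-- Every cell of a partition lies in the rows and columns before its size. -/
theorem add_lt_card (μ : Partition) {i j : ℕ} (h : (i, j) ∈ μ) : i < μ.card ∧ j < μ.card := by
  constructor
  · have h1 : μ.colLen j ≤ μ.card := by
      rw [YoungDiagram.colLen_eq_card]
      exact Finset.card_le_card (Finset.filter_subset _ _)
    exact (YoungDiagram.mem_iff_lt_colLen.1 h).trans_le h1
  · have h1 : μ.rowLen i ≤ μ.card := by
      rw [YoungDiagram.rowLen_eq_card]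
      exact Finset.card_le_card (Finset.filter_subset _ _)
    exact (YoungDiagram.mem_iff_lt_rowLen.1 h).trans_le h1

theorem finite_card_eq (M : ℕ) : {ν : Partition | ν.card = M}.Finite := by
  refine Set.Finite.of_finite_image (f := YoungDiagram.cells)
    ((Finset.finite_toSet (Finset.range M ×ˢ Finset.range M).powerset).subset ?_) ?_
  · rintro _ ⟨ν, rfl, rfl⟩
    simp only [Finset.coe_powerset, Set.mem_preimage, Set.mem_powerset_iff, Finset.coe_subset]
    rintro ⟨i, j⟩ hc
    have := add_lt_card ν (YoungDiagram.mem_cells _ |>.1 hc)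
    simp only [Finset.mem_product, Finset.mem_range]
    exact this
  · intro μ _ ν _ h
    exact YoungDiagram.ext h

theorem card_eq_sum_rowLen (μ : Partition) {N : ℕ} (hN : μ.colLen 0 ≤ N) :
    μ.card = ∑ i ∈ Finset.range N, μ.rowLen i := by
  rw [YoungDiagram.card, Finset.card_eq_sum_card_fiberwise (f := Prod.fst) (t := Finset.range N)]
  · refine Finset.sum_congr rfl fun i _ => ?_
    rw [YoungDiagram.rowLen_eq_card]
    rfl
  · rintro ⟨i, j⟩ hc
    have hc' : (i, j) ∈ μ := (YoungDiagram.mem_cells _).1 hc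
    have := YoungDiagram.mem_iff_lt_rowLen.1 hc'
    exact Finset.mem_coe.2 (Finset.mem_range.2 ((lt_colLen_zero μ (Nat.ne_zero_of_lt this)).trans_le hN))

theorem degree_parts (μ : Partition) : (parts μ).degree = μ.card := by
  rw [card_eq_sum_rowLen μ le_rfl, Finsupp.degree_apply]
  exact Finset.sum_subset (Finsupp.support_onFinset_subset) fun i _ hi => by
    simpa [Finsupp.mem_support_iff] using hi

/-- The partition with `x` parts equal to `n` and `k` parts equal to `y`. -/
def hook (x n k y : ℕ) (hy : y ≤ n) : Partition :=
  ofParts (fun i => if i < x then n else if i < x + k then y else 0)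
    (by intro i j hij; dsimp only; split_ifs <;> omega) (x + k) (by simp)

theorem rowLen_hook (x n k y : ℕ) (hy : y ≤ n) (i : ℕ) :
    (hook x n k y hy).rowLen i = if i < x then n else if i < x + k then y else 0 :=
  rowLen_ofParts _ _ _ _ _

/-- The rectangular partition with `x` parts equal to `n`. -/
def rect (x n : ℕ) : Partition := hook x n 0 n le_rfl

theorem rowLen_rect (x n i : ℕ) : (rect x n).rowLen i = if i < x then n else 0 := by
  rw [rect, rowLen_hook]
  split_ifs <;> first | rfl | omega

theorem rect_le_iff (x n : ℕ) (μ : Partition) : rect (x + 1) n ≤ μ ↔ n ≤ μ.rowLen x := by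
  rw [le_iff_rowLen]
  constructor
  · intro h
    simpa [rowLen_rect] using h x
  · intro h i
    rw [rowLen_rect]
    split_ifs with hi
    · exact h.trans (μ.rowLen_anti _ _ (by omega))
    · exact Nat.zero_le _

/-- A nonempty-complement family of partitions that is closed downwards and under the extension
of fat hooks consists of the partitions not containing a certain rectangle. -/
theorem existsUnique_rect (N : Partition → Prop) (bot : N ⊥)
    (down : ∀ μ ν, μ ≤ ν → N ν → N μ)
    (ext : ∀ x n k y (h : y < n), N (hook x n k y h.le) → N (rect (x + 1) y) →
      ¬ N (rect (x + 1) (y + 1)) → N (hook x n (k + 1) y h.le))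
    (hne : ∃ μ, ¬ N μ) :
    ∃! p : ℕ × ℕ, ∀ μ : Partition, ¬ N μ ↔ p.2 + 1 ≤ μ.rowLen p.1 := by
  classical
  obtain ⟨μ₀, hμ₀⟩ := hne
  have hX : ∃ X, ∃ n, ¬ N (rect X n) := by
    refine ⟨μ₀.colLen 0, μ₀.rowLen 0, fun h => hμ₀ (down _ _ (le_iff_rowLen.2 fun i => ?_) h)⟩
    rw [rowLen_rect]
    split_ifs with hi
    · exact μ₀.rowLen_anti _ _ (Nat.zero_le i)
    · rw [rowLen_colLen_zero μ₀ (not_lt.1 hi)]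
  have rect_zero (n : ℕ) : rect 0 n = ⊥ := rowLen_injective fun i => by simp [rowLen_rect]
  have rect_zero' (x : ℕ) : rect x 0 = ⊥ := rowLen_injective fun i => by simp [rowLen_rect]
  -- By minimality of the height x + 1, all rectangles with x rows satisfy `N`, whatever their
  -- width; these start the induction on hooks.
  obtain ⟨x, hx⟩ : ∃ x, Nat.find hX = x + 1 := Nat.exists_eq_succ_of_ne_zero fun h => by
    obtain ⟨n, hn⟩ := Nat.find_spec hX
    rw [h, rect_zero] at hn
    exact hn bot
  have hxn (n : ℕ) : N (rect x n) := by
    by_contra h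
    exact Nat.find_min hX (m := x) (by omega) ⟨n, h⟩
  have hY : ∃ n, ¬ N (rect (x + 1) n) := hx ▸ Nat.find_spec hX
  obtain ⟨y, hy⟩ : ∃ y, Nat.find hY = y + 1 := Nat.exists_eq_succ_of_ne_zero fun h => by
    have hn := Nat.find_spec hY
    rw [h, rect_zero'] at hn
    exact hn bot
  have hy1 : ¬ N (rect (x + 1) (y + 1)) := hy ▸ Nat.find_spec hY
  have hy0 : N (rect (x + 1) y) := by
    by_contra h
    exact Nat.find_min hY (m := y) (by omega) h
  have hooks (n : ℕ) (hn : y < n) (k : ℕ) : N (hook x n k y hn.le) := by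
    induction k with
    | zero =>
      have : hook x n 0 y hn.le = rect x n :=
        rowLen_injective fun i => by
          rw [rowLen_hook, rowLen_rect]
          split_ifs <;> first | rfl | omega
      rw [this]
      exact hxn n
    | succ k ih => exact ext x n k y hn ih hy0 hy1
  have main (μ : Partition) : ¬ N μ ↔ y + 1 ≤ μ.rowLen x := by
    constructor
    · intro h
      by_contra! hlt
      -- The arm must hold the first row and exceed y; as many leg rows as `μ` has parts are enough.
      refine h (down _ _ (le_iff_rowLen.2 fun i => ?_)
        (hooks (max (μ.rowLen 0) (y + 1)) (by omega) (μ.colLen 0)))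
      rw [rowLen_hook]
      have h0 := μ.rowLen_anti 0 i (Nat.zero_le i)
      split_ifs with h1 h2
      · omega
      · have := μ.rowLen_anti x i (by omega)
        omega
      · rw [rowLen_colLen_zero μ (by omega)]
    · intro h hN
      exact hy1 (down _ _ ((rect_le_iff _ _ _).2 h) hN)
  refine ⟨(x, y), main, ?_⟩
  rintro ⟨x', y'⟩ h
  -- Each pair is tested on the minimal rectangle of the other.
  have h1 := (main (rect (x' + 1) (y' + 1))).1 ((h _).2 (by simp [rowLen_rect]))
  have h2 := (h (rect (x + 1) (y + 1))).1 ((main _).2 (by simp [rowLen_rect]))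
  rw [rowLen_rect] at h1 h2
  dsimp only at h2
  split_ifs at h1 h2
  · simp only [Prod.mk.injEq]
    omega
  all_goals omega

end SymmetricFunctions

/-! ### Products of monomial symmetric functions. -/

namespace SymmetricFunctions

/-- The exponent `d` is a rearrangement of the parts of `μ`. -/
def IsRearrangement (d : ℕ →₀ ℕ) (μ : Partition) : Prop :=
  ∃ σ : Equiv.Perm ℕ, ∀ i, d (σ i) = μ.rowLen i

theorem isRearrangement_parts (μ : Partition) : IsRearrangement (parts μ) μ :=
  ⟨1, fun _ => rfl⟩

theorem isRearrangement_iff_equivMapDomain {d : ℕ →₀ ℕ} {μ : Partition} :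
    IsRearrangement d μ ↔ ∃ σ : Equiv.Perm ℕ, d.equivMapDomain σ = parts μ := by
  constructor
  · rintro ⟨σ, h⟩
    exact ⟨σ.symm, by ext i; simpa [Finsupp.equivMapDomain_apply] using h i⟩
  · rintro ⟨σ, h⟩
    exact ⟨σ.symm, fun i => by simpa [Finsupp.equivMapDomain_apply] using DFunLike.congr_fun h i⟩

theorem isRearrangement_equivMapDomain (σ : Equiv.Perm ℕ) {d : ℕ →₀ ℕ} {μ : Partition} :
    IsRearrangement (d.equivMapDomain σ) μ ↔ IsRearrangement d μ := by
  constructor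
  · rintro ⟨τ, h⟩
    exact ⟨τ.trans σ.symm, fun i => by simpa [Finsupp.equivMapDomain_apply] using h i⟩
  · rintro ⟨τ, h⟩
    exact ⟨τ.trans σ, fun i => by simpa [Finsupp.equivMapDomain_apply] using h i⟩

theorem coeff_monomialSymm (μ : Partition) (d : ℕ →₀ ℕ) [Decidable (IsRearrangement d μ)] :
    MvPowerSeries.coeff d (monomialSymm μ) = if IsRearrangement d μ then 1 else 0 := by
  change monomialSymm μ d = _
  unfold monomialSymm IsRearrangement
  congr

/-- If at least `i + 1` exponents of `d` are at least `t`, then so is the part with index `i`. -/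
theorem IsRearrangement.le_rowLen {d : ℕ →₀ ℕ} {μ : Partition} (h : IsRearrangement d μ)
    {S : Finset ℕ} {t i : ℕ} (hS : ∀ p ∈ S, t ≤ d p) (hi : i < S.card) : t ≤ μ.rowLen i := by
  obtain ⟨σ, hσ⟩ := h
  obtain ⟨q, hq, hqi⟩ : ∃ q ∈ S.map σ.symm.toEmbedding, q ∉ Finset.range i :=
    Finset.exists_mem_notMem_of_card_lt_card (by simpa using hi)
  rw [Finset.mem_map_equiv, Equiv.symm_symm] at hq
  exact (hS _ hq).trans ((hσ q).trans_le (μ.rowLen_anti _ _ (by simpa using hqi)))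

/-- Beyond some N the exponent is zero, so it suffices to sort the first N entries in the dual order
and fix the other indices. -/
theorem exists_antitone_rearrangement (d : ℕ →₀ ℕ) :
    ∃ σ : Equiv.Perm ℕ, Antitone (d ∘ σ) := by
  classical
  obtain ⟨N, hN⟩ : ∃ N, ∀ i, N ≤ i → d i = 0 := by
    refine ⟨d.support.sup id + 1, fun i hi => ?_⟩
    by_contra h
    have := Finset.le_sup (f := id) (Finsupp.mem_support_iff.2 h)
    simp only [id] at this
    omega
  let f : Fin N → ℕᵒᵈ := fun i => OrderDual.toDual (d i)
  let τ : Equiv.Perm (Fin N) := Tuple.sort f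
  have hτ : Monotone (f ∘ τ) := Tuple.monotone_sort f
  refine ⟨τ.viaEmbedding Fin.valEmbedding, fun i j hij => ?_⟩
  by_cases hj : j < N
  · have h (k : Fin N) : τ.viaEmbedding Fin.valEmbedding (k : ℕ) = (τ k : ℕ) :=
      Equiv.Perm.viaEmbedding_apply τ Fin.valEmbedding k
    have := hτ (a := ⟨i, by omega⟩) (b := ⟨j, hj⟩) hij
    simp only [Function.comp_apply]
    have hi := h ⟨i, by omega⟩
    have hj := h ⟨j, hj⟩
    simp only at hi hj
    rw [hi, hj]
    exact this
  · have : τ.viaEmbedding Fin.valEmbedding j = j :=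
      Equiv.Perm.viaEmbedding_apply_of_notMem _ _ _ (by
        rintro ⟨k, rfl⟩
        exact hj k.2)
    simp only [Function.comp_apply]
    rw [this, hN j (by omega)]
    exact Nat.zero_le _

theorem exists_isRearrangement (d : ℕ →₀ ℕ) : ∃ μ, IsRearrangement d μ := by
  obtain ⟨σ, hσ⟩ := exists_antitone_rearrangement d
  obtain ⟨N, hN⟩ : ∃ N, (d ∘ σ) N = 0 := by
    obtain ⟨N, hN⟩ := Infinite.exists_notMem_finset d.support
    exact ⟨σ.symm N, by simpa using hN⟩
  refine ⟨ofParts (d ∘ σ) hσ N hN, σ, fun i => ?_⟩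
  rw [rowLen_ofParts, Function.comp_apply]

/-- The part with index i is the largest t such that at least i + 1 exponents are at least t, which
does not depend on the order. -/
theorem IsRearrangement.unique {d : ℕ →₀ ℕ} {μ ν : Partition} (hμ : IsRearrangement d μ)
    (hν : IsRearrangement d ν) : μ = ν := by
  have key {μ ν : Partition} (hμ : IsRearrangement d μ) (hν : IsRearrangement d ν) (i : ℕ) :
      μ.rowLen i ≤ ν.rowLen i := by
    obtain ⟨σ, hσ⟩ := hμ
    refine hν.le_rowLen (S := (Finset.range (i + 1)).map σ.toEmbedding) (fun p hp => ?_) (by simp)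
    obtain ⟨q, hq, rfl⟩ := Finset.mem_map.1 hp
    rw [Equiv.coe_toEmbedding, hσ]
    exact μ.rowLen_anti _ _ (by simpa [Nat.lt_succ_iff] using hq)
  exact rowLen_injective fun i => le_antisymm (key hμ hν i) (key hν hμ i)

theorem degree_equivMapDomain (σ : Equiv.Perm ℕ) (d : ℕ →₀ ℕ) :
    (d.equivMapDomain σ).degree = d.degree := by
  rw [Finsupp.equivMapDomain_eq_mapDomain, Finsupp.degree_mapDomain]

theorem IsRearrangement.degree_eq {d : ℕ →₀ ℕ} {μ : Partition} (h : IsRearrangement d μ) :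
    d.degree = μ.card := by
  obtain ⟨σ, h⟩ := isRearrangement_iff_equivMapDomain.1 h
  rw [← degree_equivMapDomain σ, h, degree_parts]

theorem equivMapDomain_add (σ : Equiv.Perm ℕ) (d e : ℕ →₀ ℕ) :
    (d + e).equivMapDomain σ = d.equivMapDomain σ + e.equivMapDomain σ := by
  ext i
  simp [Finsupp.equivMapDomain_apply]

open Classical in
/-- The pairs of rearrangements of `μ` and `ν` with sum `d`. -/
def rearrangementPairs (μ ν : Partition) (d : ℕ →₀ ℕ) : Finset ((ℕ →₀ ℕ) × (ℕ →₀ ℕ)) :=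
  (Finset.HasAntidiagonal.antidiagonal d).filter fun p => IsRearrangement p.1 μ ∧ IsRearrangement p.2 ν

theorem coeff_monomialSymm_mul (μ ν : Partition) (d : ℕ →₀ ℕ) :
    MvPowerSeries.coeff d (monomialSymm μ * monomialSymm ν) =
      ((rearrangementPairs μ ν d).card : ℤ) := by
  classical
  rw [MvPowerSeries.coeff_mul, rearrangementPairs, Finset.card_filter]
  push_cast
  refine Finset.sum_congr rfl fun p _ => ?_
  rw [coeff_monomialSymm, coeff_monomialSymm]
  split_ifs <;> simp_all

theorem card_rearrangementPairs_equivMapDomain (σ : Equiv.Perm ℕ) (μ ν : Partition)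
    (d : ℕ →₀ ℕ) : (rearrangementPairs μ ν (d.equivMapDomain σ)).card =
      (rearrangementPairs μ ν d).card := by
  classical
  have h (τ : Equiv.Perm ℕ) (e : ℕ →₀ ℕ) :
      (rearrangementPairs μ ν e).card ≤ (rearrangementPairs μ ν (e.equivMapDomain τ)).card := by
    refine Finset.card_le_card_of_injOn
      (fun p => (p.1.equivMapDomain τ, p.2.equivMapDomain τ)) ?_ ?_
    · intro p hp
      simp only [rearrangementPairs, Finset.coe_filter, Finset.HasAntidiagonal.mem_antidiagonal,
        Set.mem_ofPred_eq, isRearrangement_equivMapDomain] at hp ⊢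
      exact ⟨by rw [← equivMapDomain_add, hp.1], hp.2⟩
    · intro p _ q _ hpq
      simp only [Prod.mk.injEq] at hpq
      exact Prod.ext ((Finsupp.equivCongrLeft τ).injective hpq.1)
        ((Finsupp.equivCongrLeft τ).injective hpq.2)
  refine le_antisymm ?_ (h σ d)
  refine (h σ.symm _).trans_eq ?_
  rw [← Finsupp.equivMapDomain_trans, Equiv.self_trans_symm, Finsupp.equivMapDomain_refl]

/-- The product is symmetric, so its coefficient at an exponent equals that at the sorted exponent
`parts ξ`. Homogeneity restricts `ξ` to a finite set. -/
theorem monomialSymm_mul (μ ν : Partition) :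
    monomialSymm μ * monomialSymm ν =
      ∑ ξ ∈ (finite_card_eq (μ.card + ν.card)).toFinset,
        (rearrangementPairs μ ν (parts ξ)).card • monomialSymm ξ := by
  classical
  ext d
  rw [coeff_monomialSymm_mul, map_sum]
  obtain ⟨ξ, hξ⟩ := exists_isRearrangement d
  have hcard : (rearrangementPairs μ ν d).card = (rearrangementPairs μ ν (parts ξ)).card := by
    obtain ⟨σ, h⟩ := isRearrangement_iff_equivMapDomain.1 hξ
    rw [← h, card_rearrangementPairs_equivMapDomain]
  rw [Finset.sum_eq_single ξ]
  · rw [map_nsmul, coeff_monomialSymm, if_pos hξ, hcard]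
    simp
  · intro ξ' _ hne
    rw [map_nsmul, coeff_monomialSymm, if_neg fun h => hne (h.unique hξ), smul_zero]
  · intro hmem
    rw [map_nsmul, coeff_monomialSymm, if_pos hξ]
    have : rearrangementPairs μ ν (parts ξ) = ∅ := by
      by_contra hne
      obtain ⟨p, hp⟩ := Finset.nonempty_iff_ne_empty.2 hne
      simp only [rearrangementPairs, Finset.mem_filter, Finset.HasAntidiagonal.mem_antidiagonal] at hp
      refine hmem ((Set.Finite.mem_toFinset _).2 ?_)
      have := congrArg Finsupp.degree hp.1
      rw [map_add, hp.2.1.degree_eq, hp.2.2.degree_eq, degree_parts] at this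
      exact this.symm
    rw [this]
    simp

theorem LambdaNat.m_mul (μ ν : Partition) :
    LambdaNat.m μ * LambdaNat.m ν =
      ∑ ξ ∈ (finite_card_eq (μ.card + ν.card)).toFinset,
        (rearrangementPairs μ ν (parts ξ)).card • LambdaNat.m ξ := by
  apply Subtype.ext
  change monomialSymm μ * monomialSymm ν = LambdaNat.subtype _
  rw [monomialSymm_mul, map_sum]
  refine Finset.sum_congr rfl fun ξ _ => ?_
  rw [map_nsmul]
  rfl

theorem LambdaNat.m_bot : LambdaNat.m ⊥ = 1 := by
  classical
  apply Subtype.ext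
  change monomialSymm ⊥ = 1
  ext d
  rw [coeff_monomialSymm, MvPowerSeries.coeff_one]
  refine if_congr ⟨?_, ?_⟩ rfl rfl
  · rintro ⟨σ, h⟩
    ext i
    simpa using h (σ.symm i)
  · rintro rfl
    exact ⟨1, fun i => by simp⟩

/-! ### Vanishing of big Witt vectors. -/

namespace IsZerosumfreeDomain

variable {A : Type*} [CommSemiring A]

theorem sum_ne_zero_iff (hA : IsZerosumfreeDomain A) {ι : Type*} (s : Finset ι) (f : ι → A) :
    ∑ i ∈ s, f i ≠ 0 ↔ ∃ i ∈ s, f i ≠ 0 := by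
  classical
  induction s using Finset.induction_on with
  | empty => simp
  | insert i s hi ih =>
    rw [Finset.sum_insert hi]
    constructor
    · intro h
      by_contra! h'
      have h1 : ∑ j ∈ s, f j = 0 := by
        by_contra h2
        obtain ⟨j, hj, hj'⟩ := ih.1 h2
        exact hj' (h' j (Finset.mem_insert_of_mem hj))
      rw [h1, h' i (Finset.mem_insert_self _ _), add_zero] at h
      exact h rfl
    · rintro ⟨j, hj, hj'⟩ h
      obtain ⟨h1, h2⟩ := hA.eq_zero_of_add _ _ h
      rcases Finset.mem_insert.1 hj with rfl | hj
      · exact hj' h1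
      · exact ih.2 ⟨j, hj, hj'⟩ h2

theorem nsmul_ne_zero_iff (hA : IsZerosumfreeDomain A) (n : ℕ) (x : A) :
    n • x ≠ 0 ↔ n ≠ 0 ∧ x ≠ 0 := by
  have := hA.sum_ne_zero_iff (Finset.range n) fun _ => x
  rw [Finset.sum_const, Finset.card_range] at this
  rw [this]
  constructor
  · rintro ⟨i, hi, h⟩
    exact ⟨by rintro rfl; simp at hi, h⟩
  · rintro ⟨hn, h⟩
    exact ⟨0, Finset.mem_range.2 (Nat.pos_of_ne_zero hn), h⟩

theorem mul_ne_zero_iff (hA : IsZerosumfreeDomain A) (x y : A) :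
    x * y ≠ 0 ↔ x ≠ 0 ∧ y ≠ 0 := by
  constructor
  · intro h
    exact ⟨left_ne_zero_of_mul h, right_ne_zero_of_mul h⟩
  · rintro ⟨hx, hy⟩ h
    exact (hA.eq_zero_of_mul _ _ h).elim hx hy

/-- The product of the values at two monomial symmetric functions is nonzero if and only if the
value is nonzero at some term of their product. -/
theorem map_m_mul_ne_zero_iff (hA : IsZerosumfreeDomain A) (a : BigWitt A) (μ ν : Partition) :
    (a (LambdaNat.m μ) ≠ 0 ∧ a (LambdaNat.m ν) ≠ 0) ↔
      ∃ ξ d e, IsRearrangement d μ ∧ IsRearrangement e ν ∧ IsRearrangement (d + e) ξ ∧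
        a (LambdaNat.m ξ) ≠ 0 := by
  classical
  rw [← hA.mul_ne_zero_iff, ← map_mul, LambdaNat.m_mul, map_sum, hA.sum_ne_zero_iff]
  simp only [map_nsmul, hA.nsmul_ne_zero_iff, Set.Finite.mem_toFinset]
  constructor
  · rintro ⟨ξ, _, h1, h2⟩
    obtain ⟨p, hp⟩ := Finset.card_ne_zero.1 h1
    simp only [rearrangementPairs, Finset.mem_filter, Finset.HasAntidiagonal.mem_antidiagonal] at hp
    exact ⟨ξ, p.1, p.2, hp.2.1, hp.2.2, hp.1 ▸ isRearrangement_parts ξ, h2⟩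
  · rintro ⟨ξ, d, e, hd, he, h, hξ⟩
    refine ⟨ξ, ?_, ?_, hξ⟩
    · have := h.degree_eq
      rw [map_add, hd.degree_eq, he.degree_eq] at this
      exact this.symm
    · obtain ⟨σ, hσ⟩ := isRearrangement_iff_equivMapDomain.1 h
      rw [← hσ, card_rearrangementPairs_equivMapDomain]
      refine Finset.card_ne_zero.2 ⟨(d, e), ?_⟩
      simp [rearrangementPairs, hd, he]

theorem bigWitt_existsUnique (hA : IsZerosumfreeDomain A) (a : BigWitt A)
    (h : ∃ μ, a (LambdaNat.m μ) = 0) :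
    ∃! p : ℕ × ℕ, ∀ μ, a (LambdaNat.m μ) = 0 ↔ p.2 + 1 ≤ μ.rowLen p.1 := by
  classical
  have down (μ ν : Partition) (hle : μ ≤ ν) (hν : a (LambdaNat.m ν) ≠ 0) :
      a (LambdaNat.m μ) ≠ 0 := by
    -- The parts of `ν` are those of `μ` plus the difference, so `ν` occurs in the product of `μ`
    -- with the sorted difference.
    obtain ⟨ξ, hξ⟩ := exists_isRearrangement (parts ν - parts μ)
    refine ((hA.map_m_mul_ne_zero_iff a μ ξ).2
      ⟨ν, parts μ, _, isRearrangement_parts μ, hξ, ?_, hν⟩).1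
    rw [add_tsub_cancel_of_le fun i => le_iff_rowLen.1 hle i]
    exact isRearrangement_parts ν
  have := existsUnique_rect (fun μ => a (LambdaNat.m μ) ≠ 0) ?_ down ?_
    (by simpa only [not_not] using h)
  · simpa only [not_not] using this
  · have := hA.nontrivial
    rw [LambdaNat.m_bot, map_one]
    exact one_ne_zero
  · intro x n k y hyn h1 h2 h3
    obtain ⟨ν, d, e, hd, he, hde, hν⟩ := (hA.map_m_mul_ne_zero_iff a _ _).1 ⟨h1, h2⟩
    refine down _ _ (le_iff_rowLen.2 fun i => ?_) hν
    have hνx : ν.rowLen x ≤ y := by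
      by_contra! h
      exact h3 (down _ _ ((rect_le_iff _ _ _).2 h) hν)
    obtain ⟨σ, hσ⟩ := hd
    obtain ⟨τ, hτ⟩ := he
    simp only [rowLen_hook, rowLen_rect] at hσ hτ
    have harm : n ≤ ν.rowLen i ∨ x ≤ i := by
      refine or_iff_not_imp_right.2 fun hi => hde.le_rowLen
        (S := (Finset.range x).map σ.toEmbedding) (fun p hp => ?_) (by simpa using hi)
      obtain ⟨q, hq, rfl⟩ := Finset.mem_map.1 hp
      have := hσ q
      rw [if_pos (Finset.mem_range.1 hq)] at this
      rw [Equiv.coe_toEmbedding, Finsupp.add_apply, this]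
      omega
    have hleg : y ≤ ν.rowLen (x + k) := by
      rcases Nat.eq_zero_or_pos y with rfl | hy
      · exact Nat.zero_le _
      -- Some position of the rectangle is not one of the x arm positions. The hook exponent there
      -- must be 0, or else x + 1 exponents of the sum would exceed y. Hence it is a new position
      -- beside the x + k of the hook.
      obtain ⟨q, hq, hq'⟩ : ∃ q ∈ (Finset.range (x + 1)).map τ.toEmbedding,
          q ∉ (Finset.range x).map σ.toEmbedding :=
        Finset.exists_mem_notMem_of_card_lt_card (by simp)
      obtain ⟨r, hr, rfl⟩ := Finset.mem_map.1 hq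
      have her := hτ r
      rw [if_pos (Finset.mem_range.1 hr)] at her
      have hqd : d (τ r) = 0 := by
        by_contra hne
        have : y + 1 ≤ ν.rowLen x := by
          refine hde.le_rowLen
            (S := insert (τ r) ((Finset.range x).map σ.toEmbedding)) (fun p hp => ?_) ?_
          · rcases Finset.mem_insert.1 hp with rfl | hp
            · rw [Finsupp.add_apply]
              omega
            · obtain ⟨q, hq, rfl⟩ := Finset.mem_map.1 hp
              have := hσ q
              rw [if_pos (Finset.mem_range.1 hq)] at this
              rw [Equiv.coe_toEmbedding, Finsupp.add_apply, this]
              omega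
          · rw [Finset.card_insert_of_notMem (by exact hq')]
            simp
        omega
      refine hde.le_rowLen
        (S := insert (τ r) ((Finset.range (x + k)).map σ.toEmbedding)) (fun p hp => ?_) ?_
      · rcases Finset.mem_insert.1 hp with rfl | hp
        · rw [Finsupp.add_apply]
          omega
        · obtain ⟨q, hq, rfl⟩ := Finset.mem_map.1 hp
          have := hσ q
          have hqk := Finset.mem_range.1 hq
          rw [Equiv.coe_toEmbedding, Finsupp.add_apply, this]
          split_ifs <;> omega
      · rw [Finset.card_insert_of_notMem]
        · simp
        · intro hmem
          obtain ⟨q, hq, hq2⟩ := Finset.mem_map.1 hmem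
          rw [Equiv.coe_toEmbedding] at hq2
          have := hσ q
          have hqk := Finset.mem_range.1 hq
          rw [hq2, hqd] at this
          split_ifs at this <;> omega
    rw [rowLen_hook]
    split_ifs with hi hi'
    · exact harm.resolve_right (by omega)
    · exact hleg.trans (ν.rowLen_anti _ _ (by omega))
    · exact Nat.zero_le _

end IsZerosumfreeDomain

end SymmetricFunctions

/-! ### Gelfand–Tsetlin patterns and truncated Bender–Knuth involutions. -/

namespace SymmetricFunctions

/-- The number of entries less than `k` in row `i` of a tableau. -/
def rowCount {μ : Partition} (T : SemistandardYoungTableau μ) (k i : ℕ) : ℕ :=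
  ((Finset.range (μ.rowLen i)).filter fun c => T i c < k).card

/-- Rows increase weakly, so the entries below k form an initial segment of the row. -/
theorem lt_rowCount_iff {μ : Partition} (T : SemistandardYoungTableau μ) {k i c : ℕ} :
    c < rowCount T k i ↔ (i, c) ∈ μ ∧ T i c < k := by
  have key {S : Finset ℕ} (hS : ∀ a b, a ≤ b → b ∈ S → a ∈ S) : c < S.card ↔ c ∈ S := by
    constructor
    · intro h
      obtain ⟨b, hb, hb'⟩ : ∃ b ∈ S, b ∉ Finset.range c :=
        Finset.exists_mem_notMem_of_card_lt_card (by simpa using h)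
      exact hS c b (by simpa using hb') hb
    · intro h
      have : Finset.range (c + 1) ⊆ S := fun a ha =>
        hS a c (by simpa [Nat.lt_succ_iff] using ha) h
      simpa using Finset.card_le_card this
  rw [rowCount, key]
  · simp [YoungDiagram.mem_iff_lt_rowLen]
  · intro a b hab hb
    simp only [Finset.mem_filter, Finset.mem_range] at hb ⊢
    exact ⟨by omega, (T.row_weak_of_le hab (YoungDiagram.mem_iff_lt_rowLen.2 hb.1)).trans_lt hb.2⟩

theorem ext_of_lt_iff {m n : ℕ} (h : ∀ c, c < m ↔ c < n) : m = n :=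
  le_antisymm (not_lt.1 fun h' => lt_irrefl _ ((h _).1 h'))
    (not_lt.1 fun h' => lt_irrefl _ ((h _).2 h'))

theorem le_of_lt_imp {m n : ℕ} (h : ∀ c, c < m → c < n) : m ≤ n :=
  not_lt.1 fun h' => lt_irrefl _ (h _ h')

theorem entry_eq_of_rowCount {μ : Partition} {T T' : SemistandardYoungTableau μ} {i c : ℕ}
    (h : ∀ k, c < rowCount T k i ↔ c < rowCount T' k i) : T i c = T' i c := by
  by_cases hc : (i, c) ∈ μ
  · simp only [lt_rowCount_iff, hc, true_and] at h
    exact le_antisymm (not_lt.1 fun h' => lt_irrefl _ ((h _).2 h'))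
      (not_lt.1 fun h' => lt_irrefl _ ((h _).1 h'))
  · rw [T.zeros hc, T'.zeros hc]

/-- The interlacing conditions satisfied by the row counts of a tableau of shape `μ`. -/
structure IsPattern (μ : Partition) (r : ℕ → ℕ → ℕ) : Prop where
  zero : ∀ i, r 0 i = 0
  mono : ∀ k i, r k i ≤ r (k + 1) i
  interlace : ∀ k i, r (k + 1) (i + 1) ≤ r k i
  eventually : ∀ i, ∃ K, ∀ k, K ≤ k → r k i = μ.rowLen i

theorem isPattern_rowCount {μ : Partition} (T : SemistandardYoungTableau μ) :
    IsPattern μ (rowCount T) where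
  zero i := by simp [rowCount]
  mono k i := le_of_lt_imp fun c => by
    simp only [lt_rowCount_iff]
    exact fun h => ⟨h.1, by omega⟩
  interlace k i := le_of_lt_imp fun c => by
    simp only [lt_rowCount_iff]
    intro h
    have := T.col_strict (show i < i + 1 by omega) h.1
    exact ⟨μ.up_left_mem (Nat.le_succ i) le_rfl h.1, by omega⟩
  eventually i := by
    -- The last entry of the row is its largest. For an empty row the truncated index is harmless,
    -- as there is no cell to check.
    refine ⟨T i (μ.rowLen i - 1) + 1, fun k hk => ext_of_lt_iff fun c => ?_⟩
    rw [lt_rowCount_iff, YoungDiagram.mem_iff_lt_rowLen]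
    refine ⟨fun h => h.1, fun h => ⟨h, ?_⟩⟩
    have := T.row_weak_of_le (i := i) (show c ≤ μ.rowLen i - 1 by omega)
      (YoungDiagram.mem_iff_lt_rowLen.2 (by omega))
    omega

theorem IsPattern.monotone {μ : Partition} {r : ℕ → ℕ → ℕ} (h : IsPattern μ r) (i : ℕ) :
    Monotone fun k => r k i :=
  monotone_nat_of_le_succ fun k => h.mono k i

theorem IsPattern.le_rowLen {μ : Partition} {r : ℕ → ℕ → ℕ} (h : IsPattern μ r) (k i : ℕ) :
    r k i ≤ μ.rowLen i := by
  obtain ⟨K, hK⟩ := h.eventually i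
  exact (h.monotone i (le_max_left k K)).trans_eq (hK _ (le_max_right k K))

/-- The entry at (i, c) is the least k such that `r (k + 1) i` exceeds c. Monotonicity in k makes
this well behaved, and interlacing gives strict columns. -/
theorem IsPattern.exists_tableau {μ : Partition} {r : ℕ → ℕ → ℕ} (h : IsPattern μ r) :
    ∃ T : SemistandardYoungTableau μ, rowCount T = r := by
  classical
  have hex (i c : ℕ) (hc : (i, c) ∈ μ) : ∃ k, c < r (k + 1) i := by
    obtain ⟨K, hK⟩ := h.eventually i
    exact ⟨K, (YoungDiagram.mem_iff_lt_rowLen.1 hc).trans_eq (hK _ (Nat.le_succ K)).symm⟩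
  let t (i c : ℕ) : ℕ := if hc : (i, c) ∈ μ then Nat.find (hex i c hc) else 0
  have ht {i c : ℕ} (hc : (i, c) ∈ μ) (k : ℕ) : t i c < k ↔ c < r k i := by
    simp only [t, dif_pos hc]
    cases k with
    | zero => simp [h.zero]
    | succ k =>
      rw [Nat.lt_succ_iff, Nat.find_le_iff]
      constructor
      · rintro ⟨m, hm, hm'⟩
        exact hm'.trans_le (h.monotone i (Nat.succ_le_succ hm))
      · exact fun h' => ⟨k, le_rfl, h'⟩
  let T : SemistandardYoungTableau μ :=
    { entry := t
      row_weak' := fun {i j1 j2} hj hc => by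
        have hc1 := μ.up_left_mem le_rfl hj.le hc
        exact Nat.lt_succ_iff.1 ((ht hc1 _).2 (hj.trans ((ht hc _).1 (Nat.lt_succ_self _))))
      col_strict' := fun {i1 i2 j} hi hc => by
        have hc1 := μ.up_left_mem hi.le le_rfl hc
        rw [ht hc1]
        have hanti (k i : ℕ) : r k (i + 1) ≤ r k i := (h.mono _ _).trans (h.interlace k i)
        have h1 := (ht hc _).1 (Nat.lt_succ_self _)
        have h2 : r (t i2 j + 1) i2 ≤ r (t i2 j + 1) (i1 + 1) :=
          antitone_nat_of_succ_le (hanti (t i2 j + 1)) hi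
        exact (h1.trans_le h2).trans_le (h.interlace _ _)
      zeros' := fun hc => dif_neg hc }
  refine ⟨T, funext fun k => funext fun i => ext_of_lt_iff fun c => ?_⟩
  rw [lt_rowCount_iff]
  constructor
  · rintro ⟨hc, h'⟩
    exact (ht hc k).1 h'
  · intro h'
    have hc : (i, c) ∈ μ := YoungDiagram.mem_iff_lt_rowLen.2 (h'.trans_le (h.le_rowLen k i))
    exact ⟨hc, (ht hc k).2 h'⟩

/-- The least value of the row count with index `k + 1` allowed by its neighbours. -/
def lowerBound (r : ℕ → ℕ → ℕ) (k i : ℕ) : ℕ := max (r (k + 2) (i + 1)) (r k i)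

/-- The greatest value of the row count with index `k + 1` allowed by its neighbours. -/
def upperBound (r : ℕ → ℕ → ℕ) (k : ℕ) : ℕ → ℕ
  | 0 => r (k + 2) 0
  | i + 1 => min (r k i) (r (k + 2) (i + 1))

/-- Reflect the row counts with index `k + 1` in the intervals of their allowed values that are
at most `j`. -/
def reflect (j k : ℕ) (r : ℕ → ℕ → ℕ) (l i : ℕ) : ℕ :=
  if l = k + 1 ∧ r (k + 1) i ≤ j then
    lowerBound r k i + min (upperBound r k i) j - r (k + 1) i else r l i

theorem reflect_of_ne {j k : ℕ} (r : ℕ → ℕ → ℕ) {l : ℕ} (hl : l ≠ k + 1) (i : ℕ) :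
    reflect j k r l i = r l i := if_neg fun h => hl h.1

theorem reflect_succ (j k : ℕ) (r : ℕ → ℕ → ℕ) (i : ℕ) :
    reflect j k r (k + 1) i = if r (k + 1) i ≤ j then
      lowerBound r k i + min (upperBound r k i) j - r (k + 1) i else r (k + 1) i := by
  simp [reflect]

theorem IsPattern.bounds {μ : Partition} {r : ℕ → ℕ → ℕ} (h : IsPattern μ r) (k i : ℕ) :
    lowerBound r k i ≤ r (k + 1) i ∧ r (k + 1) i ≤ upperBound r k i := by
  constructor
  · exact max_le (h.interlace _ _) (h.mono _ _)
  · cases i with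
    | zero => exact h.mono _ _
    | succ i => exact le_min (h.interlace _ _) (h.mono _ _)

theorem upperBound_le (r : ℕ → ℕ → ℕ) (k i : ℕ) : upperBound r k i ≤ r (k + 2) i := by
  cases i with
  | zero => exact le_rfl
  | succ i => exact min_le_right _ _

theorem IsPattern.reflect_bounds {μ : Partition} {r : ℕ → ℕ → ℕ} (h : IsPattern μ r)
    (j k i : ℕ) : lowerBound r k i ≤ reflect j k r (k + 1) i ∧
      reflect j k r (k + 1) i ≤ upperBound r k i := by
  have := h.bounds k i
  rw [reflect_succ]
  split_ifs <;> omega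

theorem IsPattern.reflect {μ : Partition} {r : ℕ → ℕ → ℕ} (h : IsPattern μ r) (j k : ℕ) :
    IsPattern μ (reflect j k r) where
  zero i := by rw [reflect_of_ne _ (by omega), h.zero]
  mono l i := by
    have hb := h.reflect_bounds j k i
    by_cases h1 : l = k + 1
    · subst h1
      rw [reflect_of_ne _ (l := k + 1 + 1) (by omega)]
      exact hb.2.trans (upperBound_le r k i)
    · by_cases h2 : l = k
      · subst h2
        rw [reflect_of_ne _ (l := l) (by omega)]
        exact (le_max_right _ _).trans hb.1
      · rw [reflect_of_ne _ h1, reflect_of_ne _ (by omega)]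
        exact h.mono _ _
  interlace l i := by
    by_cases h1 : l = k + 1
    · subst h1
      rw [reflect_of_ne _ (l := k + 1 + 1) (by omega)]
      exact (le_max_left _ _).trans (h.reflect_bounds j k i).1
    · by_cases h2 : l = k
      · subst h2
        rw [reflect_of_ne _ (l := l) (by omega)]
        exact (h.reflect_bounds j l (i + 1)).2.trans (min_le_left _ _)
      · rw [reflect_of_ne _ h1, reflect_of_ne _ (by omega)]
        exact h.interlace _ _
  eventually i := by
    obtain ⟨K, hK⟩ := h.eventually i
    refine ⟨max K (k + 2), fun l hl => ?_⟩
    rw [reflect_of_ne _ (by omega), hK _ (by omega)]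

/-- The bounds involve only the levels k and k + 2, which are untouched, and a reflected value stays
at most j. -/
theorem IsPattern.reflect_reflect {μ : Partition} {r : ℕ → ℕ → ℕ} (h : IsPattern μ r)
    (j k : ℕ) : SymmetricFunctions.reflect j k (SymmetricFunctions.reflect j k r) = r := by
  funext l i
  by_cases hl : l = k + 1
  · subst hl
    have hb := h.bounds k i
    have hlo : lowerBound (SymmetricFunctions.reflect j k r) k i = lowerBound r k i := by
      rw [lowerBound, reflect_of_ne _ (by omega), reflect_of_ne _ (by omega), lowerBound]
    have hhi : upperBound (SymmetricFunctions.reflect j k r) k i = upperBound r k i := by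
      cases i with
      | zero => rw [upperBound, reflect_of_ne _ (by omega), upperBound]
      | succ i =>
        rw [upperBound, reflect_of_ne _ (by omega), reflect_of_ne _ (by omega), upperBound]
    rw [reflect_succ, hlo, hhi, reflect_succ]
    split_ifs <;> omega
  · rw [reflect_of_ne _ hl, reflect_of_ne _ hl]

/-- The hypothesis `hk` says that column j has no entry k. Then reflection is the ordinary
Bender–Knuth involution of the pattern truncated at j: where the middle value exceeds j, so does its
lower bound, and all truncations equal j. -/
theorem IsPattern.sum_reflect {μ : Partition} {r : ℕ → ℕ → ℕ} (h : IsPattern μ r) {j k : ℕ}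
    (hk : ∀ i, r (k + 1) i ≤ j ∨ j < r k i) {N : ℕ} (hN : μ.rowLen N = 0) :
    ∑ i ∈ Finset.range N, min (SymmetricFunctions.reflect j k r (k + 1) i) j +
        ∑ i ∈ Finset.range N, min (r (k + 1) i) j =
      ∑ i ∈ Finset.range N, min (r k i) j + ∑ i ∈ Finset.range N, min (r (k + 2) i) j := by
  -- The lower bound of row N and the upper bound of row N + 1 are the maximum and minimum of the
  -- same two numbers, so the sum telescopes up to a boundary term that vanishes beyond the shape.
  have key (N : ℕ) : ∑ i ∈ Finset.range N, min (SymmetricFunctions.reflect j k r (k + 1) i) j +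
        ∑ i ∈ Finset.range N, min (r (k + 1) i) j + min (upperBound r k N) j =
      ∑ i ∈ Finset.range N, min (r k i) j + ∑ i ∈ Finset.range N, min (r (k + 2) i) j +
        min (r (k + 2) N) j := by
    induction N with
    | zero => simp [upperBound]
    | succ N ih =>
      simp only [Finset.sum_range_succ]
      have h1 : min (SymmetricFunctions.reflect j k r (k + 1) N) j + min (r (k + 1) N) j =
          min (lowerBound r k N) j + min (upperBound r k N) j := by
        have hb := h.bounds k N
        rcases hk N with h' | h'
        · rw [reflect_succ, if_pos h']
          omega
        · have h2 : j < lowerBound r k N := h'.trans_le (le_max_right _ _)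
          rw [reflect_succ, if_neg (by omega)]
          omega
      have h2 : min (lowerBound r k N) j + min (upperBound r k (N + 1)) j =
          min (r k N) j + min (r (k + 2) (N + 1)) j := by
        simp only [lowerBound, upperBound]
        omega
      omega
  have h1 := h.le_rowLen (k + 2) N
  have h2 := upperBound_le r k N
  have h3 := key N
  omega

/-- The Bender–Knuth involution, exchanging entries `k` and `k + 1` in the columns before `j`. -/
def benderKnuth {μ : Partition} (j k : ℕ) (T : SemistandardYoungTableau μ) :
    SemistandardYoungTableau μ :=
  ((isPattern_rowCount T).reflect j k).exists_tableau.choose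

theorem rowCount_benderKnuth {μ : Partition} (j k : ℕ) (T : SemistandardYoungTableau μ) :
    rowCount (benderKnuth j k T) = reflect j k (rowCount T) :=
  ((isPattern_rowCount T).reflect j k).exists_tableau.choose_spec

theorem benderKnuth_benderKnuth {μ : Partition} (j k : ℕ) (T : SemistandardYoungTableau μ) :
    benderKnuth j k (benderKnuth j k T) = T := by
  have : rowCount (benderKnuth j k (benderKnuth j k T)) = rowCount T := by
    rw [rowCount_benderKnuth, rowCount_benderKnuth, (isPattern_rowCount T).reflect_reflect]
  exact SemistandardYoungTableau.ext fun i c => entry_eq_of_rowCount fun l => by rw [this]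

theorem benderKnuth_apply {μ : Partition} {j k : ℕ} (T : SemistandardYoungTableau μ) {i c : ℕ}
    (hc : j ≤ c) : benderKnuth j k T i c = T i c := by
  refine entry_eq_of_rowCount fun l => ?_
  rw [rowCount_benderKnuth]
  by_cases hl : l = k + 1
  · subst hl
    have hb := (isPattern_rowCount T).bounds k i
    rw [reflect_succ]
    split_ifs <;> omega
  · rw [reflect_of_ne _ hl]

theorem benderKnuth_lt {μ : Partition} {j k n : ℕ} (hk : k + 1 < n)
    {T : SemistandardYoungTableau μ} (hT : ∀ i c, (i, c) ∈ μ → T i c < n) (i c : ℕ)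
    (hc : (i, c) ∈ μ) : benderKnuth j k T i c < n := by
  have : c < rowCount (benderKnuth j k T) n i := by
    rw [rowCount_benderKnuth, reflect_of_ne _ (by omega)]
    exact (lt_rowCount_iff T).2 ⟨hc, hT i c hc⟩
  exact ((lt_rowCount_iff _).1 this).2

/-- The weight of a tableau: the number of occurrences of each entry. -/
def weight {μ : Partition} (T : SemistandardYoungTableau μ) : ℕ →₀ ℕ :=
  ∑ c ∈ μ.cells, Finsupp.single (T c.1 c.2) 1

theorem weight_apply {μ : Partition} (T : SemistandardYoungTableau μ) (k : ℕ) :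
    weight T k = (μ.cells.filter fun c => T c.1 c.2 = k).card := by
  rw [weight, Finsupp.finsetSum_apply, Finset.card_filter]
  exact Finset.sum_congr rfl fun c _ => Finsupp.single_apply

/-- The number of occurrences of the entry `k` in the columns from `j` on. -/
def weightFrom {μ : Partition} (T : SemistandardYoungTableau μ) (j k : ℕ) : ℕ :=
  (μ.cells.filter fun c => j ≤ c.2 ∧ T c.1 c.2 = k).card

theorem weightFrom_zero {μ : Partition} (T : SemistandardYoungTableau μ) (k : ℕ) :
    weightFrom T 0 k = weight T k := by
  simp [weightFrom, weight_apply]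

theorem card_lt_eq_sum {μ : Partition} (T : SemistandardYoungTableau μ) (j k : ℕ) :
    (μ.cells.filter fun c => c.2 < j ∧ T c.1 c.2 < k).card =
      ∑ i ∈ Finset.range (μ.colLen 0), min (rowCount T k i) j := by
  rw [Finset.card_eq_sum_card_fiberwise (f := Prod.fst) (t := Finset.range (μ.colLen 0))]
  · refine Finset.sum_congr rfl fun i _ => ?_
    rw [← Finset.card_range (min (rowCount T k i) j)]
    symm
    refine Finset.card_bij (fun c _ => (i, c)) ?_ ?_ ?_
    · intro c hc
      simp only [Finset.mem_range, lt_min_iff, lt_rowCount_iff] at hc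
      simp only [Finset.mem_filter, YoungDiagram.mem_cells, and_true]
      exact ⟨hc.1.1, hc.2, hc.1.2⟩
    · intro c _ c' _ h
      exact (Prod.mk.inj h).2
    · rintro ⟨i', c⟩ hc
      simp only [Finset.mem_filter, YoungDiagram.mem_cells] at hc
      obtain ⟨⟨h1, h2, h3⟩, rfl⟩ := hc
      exact ⟨c, by simp only [Finset.mem_range, lt_min_iff, lt_rowCount_iff]; exact ⟨⟨h1, h3⟩, h2⟩,
        rfl⟩
  · rintro ⟨i, c⟩ hc
    simp only [Finset.coe_filter, YoungDiagram.mem_cells, Set.mem_ofPred_eq] at hc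
    simp only [Finset.coe_range, Set.mem_Iio]
    exact YoungDiagram.mem_iff_lt_colLen.1 (μ.up_left_mem le_rfl (Nat.zero_le _) hc.1)

/-- Both sides count the entries k everywhere and the entries below k in the columns before j. This
turns pattern sums into weights. -/
theorem weight_add_sum {μ : Partition} (T : SemistandardYoungTableau μ) (j k : ℕ) :
    weight T k + ∑ i ∈ Finset.range (μ.colLen 0), min (rowCount T k i) j =
      weightFrom T j k + ∑ i ∈ Finset.range (μ.colLen 0), min (rowCount T (k + 1) i) j := by
  rw [← card_lt_eq_sum, ← card_lt_eq_sum, weight_apply, weightFrom]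
  simp only [Finset.card_filter, ← Finset.sum_add_distrib]
  refine Finset.sum_congr rfl fun c _ => ?_
  split_ifs <;> omega

theorem weightFrom_benderKnuth {μ : Partition} {j j' : ℕ} (k : ℕ) (hj : j ≤ j')
    (T : SemistandardYoungTableau μ) (l : ℕ) :
    weightFrom (benderKnuth j k T) j' l = weightFrom T j' l := by
  unfold weightFrom
  congr 1
  refine Finset.filter_congr fun c _ => and_congr_right fun hc => ?_
  rw [benderKnuth_apply T (hj.trans hc)]

theorem weight_benderKnuth_of_ne {μ : Partition} (j : ℕ) {k l : ℕ} (hk : l ≠ k)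
    (hk' : l ≠ k + 1) (T : SemistandardYoungTableau μ) :
    weight (benderKnuth j k T) l = weight T l := by
  have h1 := weight_add_sum T j l
  have h2 := weight_add_sum (benderKnuth j k T) j l
  rw [rowCount_benderKnuth, weightFrom_benderKnuth k le_rfl] at h2
  simp only [reflect_of_ne (rowCount T) hk', reflect_of_ne (rowCount T) (show l + 1 ≠ k + 1 by omega)]
    at h2
  omega

/-- Written without subtraction: the numbers of k and k + 1 in the columns before j are exchanged.
-/
theorem weight_benderKnuth {μ : Partition} {j k : ℕ} (T : SemistandardYoungTableau μ)
    (hk : ∀ i, (i, j) ∈ μ → T i j ≠ k) :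
    weight (benderKnuth j k T) k + weightFrom T j (k + 1) =
        weight T (k + 1) + weightFrom T j k ∧
      weight (benderKnuth j k T) (k + 1) + weightFrom T j k =
        weight T k + weightFrom T j (k + 1) := by
  have h1 := weight_add_sum T j k
  have h2 := weight_add_sum (benderKnuth j k T) j k
  have h3 := weight_add_sum T j (k + 1)
  have h4 := weight_add_sum (benderKnuth j k T) j (k + 1)
  have h5 := (isPattern_rowCount T).sum_reflect (j := j) (k := k) (fun i => by
    by_contra! h
    obtain ⟨hm, hlt⟩ := (lt_rowCount_iff T).1 h.1
    refine hk i hm (le_antisymm (Nat.lt_succ_iff.1 hlt) (not_lt.1 fun h' => ?_))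
    exact absurd ((lt_rowCount_iff T).2 ⟨hm, h'⟩) h.2.not_gt) (rowLen_colLen_zero μ le_rfl)
  rw [rowCount_benderKnuth, weightFrom_benderKnuth k le_rfl] at h2 h4
  simp only [reflect_of_ne (rowCount T) (show k ≠ k + 1 by omega),
    reflect_of_ne (rowCount T) (show k + 1 + 1 ≠ k + 1 by omega)] at h2 h4
  rw [show k + 1 + 1 = k + 2 from rfl] at h3 h4
  omega

end SymmetricFunctions

/-! ### Alternants and the symmetry of Schur polynomials. -/

namespace SymmetricFunctions

open MvPolynomial

/-- Permutations of the first `n` variables, as permutations of all variables. -/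
def permHom (n : ℕ) : Equiv.Perm (Fin n) →* Equiv.Perm ℕ :=
  Equiv.Perm.viaEmbeddingHom Fin.valEmbedding

theorem permHom_apply {n : ℕ} (w : Equiv.Perm (Fin n)) (i : Fin n) : permHom n w i = w i :=
  Equiv.Perm.viaEmbedding_apply w Fin.valEmbedding i

theorem permHom_apply_of_le {n : ℕ} (w : Equiv.Perm (Fin n)) {i : ℕ} (hi : n ≤ i) :
    permHom n w i = i :=
  Equiv.Perm.viaEmbedding_apply_of_notMem _ _ _ (by
    rintro ⟨k, rfl⟩
    exact absurd k.2 hi.not_gt)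

theorem permHom_swap {n : ℕ} (a b : Fin n) :
    permHom n (Equiv.swap a b) = Equiv.swap (a : ℕ) b := by
  ext i
  by_cases hi : i < n
  · have := permHom_apply (Equiv.swap a b) ⟨i, hi⟩
    simp only at this
    rw [this]
    simp only [Equiv.swap_apply_def, Fin.ext_iff]
    split_ifs <;> rfl
  · rw [permHom_apply_of_le _ (not_lt.1 hi), Equiv.swap_apply_of_ne_of_ne] <;> omega

/-- The antisymmetrization of a polynomial in the first `n` variables. -/
def alternant (n : ℕ) (f : MvPolynomial ℕ ℤ) : MvPolynomial ℕ ℤ :=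
  ∑ w : Equiv.Perm (Fin n), (Equiv.Perm.sign w : ℤ) • rename (permHom n w) f

theorem alternant_sum (n : ℕ) {ι : Type*} (s : Finset ι) (f : ι → MvPolynomial ℕ ℤ) :
    alternant n (∑ i ∈ s, f i) = ∑ i ∈ s, alternant n (f i) := by
  simp only [alternant, map_sum, Finset.smul_sum]
  exact Finset.sum_comm

theorem alternant_mul (n : ℕ) (f g : MvPolynomial ℕ ℤ)
    (hg : ∀ w, rename (permHom n w) g = g) : alternant n (f * g) = alternant n f * g := by
  simp only [alternant, map_mul, hg, Finset.sum_mul, smul_mul_assoc]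

theorem alternant_rename_swap (n : ℕ) {a b : Fin n} (hab : a ≠ b) (f : MvPolynomial ℕ ℤ) :
    alternant n (rename (Equiv.swap (a : ℕ) b) f) = -alternant n f := by
  unfold alternant
  rw [← Finset.sum_neg_distrib]
  refine Fintype.sum_equiv (Equiv.mulRight (Equiv.swap a b)) _ _ fun w => ?_
  simp only [rename_rename, ← permHom_swap, Equiv.coe_mulRight, map_mul, Equiv.Perm.coe_mul,
    Equiv.Perm.sign_swap hab]
  simp

theorem alternant_monomial_swap {n k : ℕ} (hk : k + 1 < n) (d : ℕ →₀ ℕ) :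
    alternant n (monomial (d.equivMapDomain (Equiv.swap k (k + 1))) 1) =
      -alternant n (monomial d 1) := by
  rw [← alternant_rename_swap n (a := ⟨k, by omega⟩) (b := ⟨k + 1, hk⟩)
    (by simp [Fin.ext_iff]), rename_monomial, Finsupp.equivMapDomain_eq_mapDomain]

/-- The staircase exponent `(n - 1, n - 2, …, 0)`. -/
def staircase (n : ℕ) : ℕ →₀ ℕ :=
  Finsupp.onFinset (Finset.range n) (fun i => n - 1 - i) fun i h => by
    rw [Finset.mem_range]
    omega

@[simp]
theorem staircase_apply (n i : ℕ) : staircase n i = n - 1 - i := rfl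

/-- The exponents of the first n variables are distinct, so only the identity contributes to the
coefficient at the staircase. -/
theorem alternant_staircase_ne_zero (n : ℕ) : alternant n (monomial (staircase n) 1) ≠ 0 := by
  classical
  intro h
  have h1 := congrArg (coeff (staircase n)) h
  rw [alternant, coeff_sum, Finset.sum_eq_single 1] at h1
  · simp at h1
  · intro w _ hw
    rw [coeff_smul, rename_monomial, coeff_monomial, if_neg, smul_zero]
    intro h2
    refine hw (Equiv.ext fun i => ?_)
    have h3 := DFunLike.congr_fun h2 (w i : ℕ)
    rw [← permHom_apply, Finsupp.mapDomain_apply (permHom n w).injective, permHom_apply] at h3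
    simp only [staircase_apply] at h3
    ext
    have := i.2
    have := (w i).2
    simp only [Equiv.Perm.coe_one, id_eq]
    omega
  · simp

theorem finite_tableaux (n : ℕ) (μ : Partition) :
    {T : SemistandardYoungTableau μ | ∀ i c, (i, c) ∈ μ → T i c < n}.Finite := by
  have : Finite {T : SemistandardYoungTableau μ // ∀ i c, (i, c) ∈ μ → T i c < n} := by
    refine Finite.of_injective
      (fun T => fun c : μ.cells => (⟨T.1 c.1.1 c.1.2, T.2 _ _ c.2⟩ : Fin n)) ?_
    intro T T' h
    apply Subtype.ext
    ext i j
    by_cases hc : (i, j) ∈ μ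
    · exact congrArg Fin.val (congrFun h ⟨(i, j), hc⟩)
    · rw [T.1.zeros hc, T'.1.zeros hc]
  exact Set.finite_coe_iff.1 this

/-- The tableaux of shape `μ` with entries less than `n`. -/
def tableaux (n : ℕ) (μ : Partition) : Finset (SemistandardYoungTableau μ) :=
  (finite_tableaux n μ).toFinset

theorem mem_tableaux {n : ℕ} {μ : Partition} {T : SemistandardYoungTableau μ} :
    T ∈ tableaux n μ ↔ ∀ i c, (i, c) ∈ μ → T i c < n :=
  Set.Finite.mem_toFinset _

/-- The Schur polynomial in the first `n` variables. -/
def schurPoly (n : ℕ) (μ : Partition) : MvPolynomial ℕ ℤ :=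
  ∑ T ∈ tableaux n μ, monomial (weight T) 1

/-- With j past the last column nothing is truncated, and the involution swaps the two weights. -/
theorem weight_benderKnuth_eq {μ : Partition} {k : ℕ} (T : SemistandardYoungTableau μ)
    (j : ℕ) (hj : μ.rowLen 0 ≤ j) :
    weight (benderKnuth j k T) = (weight T).equivMapDomain (Equiv.swap k (k + 1)) := by
  have hnot (i c : ℕ) (hc : j ≤ c) : (i, c) ∉ μ := fun h => by
    have := YoungDiagram.mem_iff_lt_rowLen.1 h
    have := μ.rowLen_anti 0 i (Nat.zero_le i)
    omega
  have h0 (l : ℕ) : weightFrom T j l = 0 := by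
    rw [weightFrom, Finset.card_eq_zero, Finset.filter_eq_empty_iff]
    exact fun c hc h => hnot c.1 c.2 h.1 ((YoungDiagram.mem_cells _).1 hc)
  have := weight_benderKnuth (j := j) (k := k) T fun i hi => absurd hi (hnot i j le_rfl)
  simp only [h0, add_zero] at this
  ext l
  rw [Finsupp.equivMapDomain_apply, Equiv.symm_swap]
  by_cases h1 : l = k
  · rw [h1, Equiv.swap_apply_left, this.1]
  · by_cases h2 : l = k + 1
    · rw [h2, Equiv.swap_apply_right, this.2]
    · rw [Equiv.swap_apply_of_ne_of_ne h1 h2, weight_benderKnuth_of_ne j h1 h2]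

theorem benderKnuth_mem_tableaux {μ : Partition} {j k n : ℕ} (hk : k + 1 < n)
    {T : SemistandardYoungTableau μ} (hT : T ∈ tableaux n μ) :
    benderKnuth j k T ∈ tableaux n μ :=
  mem_tableaux.2 (benderKnuth_lt hk (mem_tableaux.1 hT))

theorem rename_swap_schurPoly {n k : ℕ} (hk : k + 1 < n) (μ : Partition) :
    rename (Equiv.swap k (k + 1)) (schurPoly n μ) = schurPoly n μ := by
  rw [schurPoly, map_sum]
  refine Finset.sum_nbij' (benderKnuth (μ.rowLen 0) k) (benderKnuth (μ.rowLen 0) k)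
    (fun T hT => benderKnuth_mem_tableaux hk hT) (fun T hT => benderKnuth_mem_tableaux hk hT)
    (fun T _ => benderKnuth_benderKnuth _ _ T) (fun T _ => benderKnuth_benderKnuth _ _ T)
    fun T _ => ?_
  rw [rename_monomial, weight_benderKnuth_eq T _ le_rfl, Finsupp.equivMapDomain_eq_mapDomain]

theorem rename_schurPoly (n : ℕ) (μ : Partition) (w : Equiv.Perm (Fin (n + 1))) :
    rename (permHom (n + 1) w) (schurPoly (n + 1) μ) = schurPoly (n + 1) μ := by
  have hw : w ∈ Submonoid.closure (Set.range fun i : Fin n => Equiv.swap i.castSucc i.succ) := by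
    rw [Equiv.Perm.mclosure_swap_castSucc_succ]
    trivial
  induction hw using Submonoid.closure_induction with
  | mem w hw =>
    obtain ⟨i, rfl⟩ := hw
    dsimp only
    rw [permHom_swap]
    exact rename_swap_schurPoly (by simp) μ
  | one => simp
  | mul v w _ _ hv hw =>
    rw [map_mul, Equiv.Perm.coe_mul, ← rename_rename, hw, hv]

end SymmetricFunctions

/-! ### The Littlewood–Richardson cancellation. -/

namespace SymmetricFunctions

open MvPolynomial

/-- The tableau `T` can be added to `ξ` column by column, from right to left, in such a way that
each step gives a partition. -/
def IsGood {μ : Partition} (ξ : Partition) (T : SemistandardYoungTableau μ) : Prop :=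
  ∀ j, Antitone fun k => ξ.rowLen k + weightFrom T j k

/-- The rightmost column `j`, and in it the smallest entry `k`, at which `T` fails to be good. -/
structure IsBadAt {μ : Partition} (ξ : Partition) (T : SemistandardYoungTableau μ)
    (j k : ℕ) : Prop where
  lt : ξ.rowLen k + weightFrom T j k < ξ.rowLen (k + 1) + weightFrom T j (k + 1)
  right : ∀ j' > j, ∀ k', ξ.rowLen (k' + 1) + weightFrom T j' (k' + 1) ≤
    ξ.rowLen k' + weightFrom T j' k'
  below : ∀ k' < k, ξ.rowLen (k' + 1) + weightFrom T j (k' + 1) ≤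
    ξ.rowLen k' + weightFrom T j k'

variable {μ ξ : Partition} {T : SemistandardYoungTableau μ} {j k : ℕ}

theorem weightFrom_eq_zero (T : SemistandardYoungTableau μ) (hj : μ.rowLen 0 ≤ j) (k : ℕ) :
    weightFrom T j k = 0 := by
  rw [weightFrom, Finset.card_eq_zero, Finset.filter_eq_empty_iff]
  intro c hc h
  have := YoungDiagram.mem_iff_lt_rowLen.1 ((YoungDiagram.mem_cells _).1 hc)
  have := μ.rowLen_anti 0 c.1 (Nat.zero_le _)
  omega

theorem exists_isBadAt (h : ¬ IsGood ξ T) : ∃ j k, IsBadAt ξ T j k := by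
  classical
  let P (j : ℕ) : Prop :=
    ∃ k, ξ.rowLen k + weightFrom T j k < ξ.rowLen (k + 1) + weightFrom T j (k + 1)
  have hP (j : ℕ) (hj : P j) : j ≤ μ.rowLen 0 := by
    obtain ⟨k, hk⟩ := hj
    by_contra! h'
    rw [weightFrom_eq_zero T h'.le, weightFrom_eq_zero T h'.le] at hk
    have := ξ.rowLen_anti k (k + 1) (Nat.le_succ k)
    omega
  obtain ⟨j₀, hj₀⟩ : ∃ j, P j := by
    by_contra! h'
    refine h fun j => antitone_nat_of_succ_le fun k => ?_
    by_contra! hlt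
    exact h' j ⟨k, hlt⟩
  have hspec : P (Nat.findGreatest P (μ.rowLen 0)) := Nat.findGreatest_spec (hP _ hj₀) hj₀
  refine ⟨_, Nat.find hspec, Nat.find_spec hspec, fun j' hj' k' => ?_, fun k' hk' => ?_⟩
  · by_contra! h'
    exact Nat.findGreatest_is_greatest hj' (hP _ ⟨k', h'⟩) ⟨k', h'⟩
  · exact not_lt.1 (Nat.find_min hspec hk')

theorem IsBadAt.unique (h : IsBadAt ξ T j k) {j' k' : ℕ} (h' : IsBadAt ξ T j' k') :
    j = j' ∧ k = k' := by
  obtain rfl : j = j' := by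
    rcases lt_trichotomy j j' with hlt | heq | hlt
    · exact absurd (h.right j' hlt k') h'.lt.not_ge
    · exact heq
    · exact absurd (h'.right j hlt k) h.lt.not_ge
  refine ⟨rfl, ?_⟩
  rcases lt_trichotomy k k' with hlt | heq | hlt
  · exact absurd (h'.below k hlt) h.lt.not_ge
  · exact heq
  · exact absurd (h.below k' hlt) h'.lt.not_ge

theorem weightFrom_eq_add (T : SemistandardYoungTableau μ) (j k : ℕ) :
    weightFrom T j k = weightFrom T (j + 1) k +
      (μ.cells.filter fun c => c.2 = j ∧ T c.1 c.2 = k).card := by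
  simp only [weightFrom, Finset.card_filter, ← Finset.sum_add_distrib]
  refine Finset.sum_congr rfl fun c _ => ?_
  split_ifs <;> omega

open Classical in
theorem weightFrom_eq_ite (T : SemistandardYoungTableau μ) (j k : ℕ) :
    weightFrom T j k = weightFrom T (j + 1) k +
      if ∃ i, (i, j) ∈ μ ∧ T i j = k then 1 else 0 := by
  rw [weightFrom_eq_add, Nat.add_left_cancel_iff]
  split_ifs with h
  · obtain ⟨i, hi, hk⟩ := h
    rw [Finset.card_eq_one]
    refine ⟨(i, j), ?_⟩
    ext ⟨i', j'⟩
    simp only [Finset.mem_filter, YoungDiagram.mem_cells, Finset.mem_singleton, Prod.mk.injEq]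
    constructor
    · rintro ⟨h1, rfl, h2⟩
      refine ⟨?_, rfl⟩
      rcases lt_trichotomy i i' with hlt | heq | hlt
      · have := T.col_strict hlt h1
        omega
      · exact heq.symm
      · have := T.col_strict hlt hi
        omega
    · rintro ⟨rfl, rfl⟩
      exact ⟨hi, rfl, hk⟩
  · rw [Finset.card_eq_zero, Finset.filter_eq_empty_iff]
    rintro ⟨i, j'⟩ hc ⟨h1, h2⟩
    dsimp only at h1 h2
    subst h1
    exact h ⟨i, (YoungDiagram.mem_cells _).1 hc, h2⟩

/-- The inequality still holds from column j + 1 on, and by strictness column j contains each entry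
at most once. So it fails by exactly one, with k + 1 present and k absent. -/
theorem IsBadAt.column (h : IsBadAt ξ T j k) :
    (∀ i, (i, j) ∈ μ → T i j ≠ k) ∧ (∃ i, (i, j) ∈ μ ∧ T i j = k + 1) ∧
      ξ.rowLen k + weightFrom T j k + 1 = ξ.rowLen (k + 1) + weightFrom T j (k + 1) := by
  classical
  have h1 := h.lt
  have h2 := h.right (j + 1) (Nat.lt_succ_self j) k
  have h3 := weightFrom_eq_ite T j k
  have h4 := weightFrom_eq_ite T j (k + 1)
  split_ifs at h3 h4 with h5 h6 h6
  · omega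
  · omega
  · exact ⟨fun i hi hk => h5 ⟨i, hi, hk⟩, h6, by omega⟩
  · omega

/-- Badness at (j, k) depends only on the columns from j on, which the involution fixes; thus the
same (j, k) is selected again. -/
theorem IsBadAt.benderKnuth (h : IsBadAt ξ T j k) :
    IsBadAt ξ (SymmetricFunctions.benderKnuth j k T) j k where
  lt := by
    rw [weightFrom_benderKnuth k le_rfl, weightFrom_benderKnuth k le_rfl]
    exact h.lt
  right j' hj' k' := by
    rw [weightFrom_benderKnuth k (le_of_lt hj'), weightFrom_benderKnuth k (le_of_lt hj')]
    exact h.right j' hj' k'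
  below k' hk' := by
    rw [weightFrom_benderKnuth k le_rfl, weightFrom_benderKnuth k le_rfl]
    exact h.below k' hk'

theorem IsBadAt.not_isGood (h : IsBadAt ξ T j k) : ¬ IsGood ξ T := fun h' =>
  h.lt.not_ge (h' j (Nat.le_succ k))

theorem IsBadAt.lt_of_mem_tableaux (h : IsBadAt ξ T j k) {n : ℕ} (hT : T ∈ tableaux n μ) :
    k + 1 < n := by
  obtain ⟨i, hi, hk⟩ := h.column.2.1
  rw [← hk]
  exact mem_tableaux.1 hT i j hi

/-- The staircase makes up for the defect of one, so `ξ`, the staircase and the columns from j on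
together give k and k + 1 equal exponents. The remaining columns have their two weights exchanged,
so the total exponent is transposed. -/
theorem IsBadAt.alternant_benderKnuth (h : IsBadAt ξ T j k) {n : ℕ} (hT : T ∈ tableaux n μ) :
    alternant n (monomial (parts ξ + staircase n +
        weight (SymmetricFunctions.benderKnuth j k T)) 1) =
      -alternant n (monomial (parts ξ + staircase n + weight T) 1) := by
  have hk := h.lt_of_mem_tableaux hT
  rw [← alternant_monomial_swap hk]
  refine congrArg (fun d => alternant n (monomial d 1)) ?_
  have h1 := weight_benderKnuth T h.column.1
  have h2 := h.column.2.2
  ext l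
  rw [Finsupp.equivMapDomain_apply, Equiv.symm_swap]
  by_cases hl : l = k
  · rw [hl, Equiv.swap_apply_left]
    simp only [Finsupp.add_apply, parts_apply, staircase_apply]
    omega
  · by_cases hl' : l = k + 1
    · rw [hl', Equiv.swap_apply_right]
      simp only [Finsupp.add_apply, parts_apply, staircase_apply]
      omega
    · rw [Equiv.swap_apply_of_ne_of_ne hl hl']
      simp only [Finsupp.add_apply, weight_benderKnuth_of_ne j hl hl']

open Classical in
theorem alternant_mul_schurPoly (n : ℕ) (ξ μ : Partition) :
    alternant (n + 1) (monomial (parts ξ + staircase (n + 1)) 1) * schurPoly (n + 1) μ =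
      ∑ T ∈ (tableaux (n + 1) μ).filter (IsGood ξ),
        alternant (n + 1) (monomial (parts ξ + staircase (n + 1) + weight T) 1) := by
  rw [← alternant_mul _ _ _ (rename_schurPoly n μ), schurPoly, Finset.mul_sum, alternant_sum]
  simp only [monomial_mul, mul_one]
  rw [← Finset.sum_filter_add_sum_filter_not _ (IsGood ξ)]
  refine add_eq_left.2 ?_
  have bad (T : SemistandardYoungTableau μ)
      (hT : T ∈ (tableaux (n + 1) μ).filter fun T => ¬ IsGood ξ T) :
      ∃ p : ℕ × ℕ, IsBadAt ξ T p.1 p.2 := by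
    obtain ⟨j, k, h⟩ := exists_isBadAt (Finset.mem_filter.1 hT).2
    exact ⟨(j, k), h⟩
  choose p hp using bad
  refine Finset.sum_involution (fun T hT => benderKnuth (p T hT).1 (p T hT).2 T) ?_ ?_ ?_ ?_
  · intro T hT
    rw [(hp T hT).alternant_benderKnuth (Finset.mem_filter.1 hT).1, add_neg_cancel]
  · intro T hT hne heq
    have := (hp T hT).alternant_benderKnuth (Finset.mem_filter.1 hT).1
    rw [heq] at this
    -- The term of a fixed point is its own negative, hence zero over ℤ.
    exact hne (self_eq_neg.1 this)
  · intro T hT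
    exact Finset.mem_filter.2 ⟨benderKnuth_mem_tableaux
      ((hp T hT).lt_of_mem_tableaux (Finset.mem_filter.1 hT).1) (Finset.mem_filter.1 hT).1,
      (hp T hT).benderKnuth.not_isGood⟩
  · intro T hT
    obtain ⟨h1, h2⟩ := (hp _ (Finset.mem_filter.2 ⟨benderKnuth_mem_tableaux
      ((hp T hT).lt_of_mem_tableaux (Finset.mem_filter.1 hT).1) (Finset.mem_filter.1 hT).1,
      (hp T hT).benderKnuth.not_isGood⟩)).unique (hp T hT).benderKnuth
    rw [h1, h2, benderKnuth_benderKnuth]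

theorem le_entry (T : SemistandardYoungTableau μ) {i j : ℕ} (h : (i, j) ∈ μ) : i ≤ T i j := by
  induction i with
  | zero => exact Nat.zero_le _
  | succ i ih =>
    have h1 := ih (μ.up_left_mem (Nat.le_succ i) le_rfl h)
    have h2 := T.col_strict (show i < i + 1 by omega) h
    omega

/-- Go through the columns from right to left and each from the top. At a first entry v + 1 above
its row index i, neither v nor v + 1 occurs further right, so v must occur in column j; but it could
only stand above row i, where the entries are the row indices, all below v. -/
theorem isGood_bot_iff : IsGood ⊥ T ↔ T = SemistandardYoungTableau.highestWeight μ := by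
  classical
  constructor
  · intro h
    have key (j' : ℕ) : ∀ j, μ.rowLen 0 ≤ j + j' → ∀ i, (i, j) ∈ μ → T i j = i := by
      induction j' with
      | zero =>
        intro j hj i hi
        have := YoungDiagram.mem_iff_lt_rowLen.1 hi
        have := μ.rowLen_anti 0 i (Nat.zero_le _)
        omega
      | succ j' ih =>
        intro j hj i
        induction i using Nat.strong_induction_on with
        | _ i IH =>
        intro hi
        by_contra hne
        have hle := le_entry T hi
        obtain ⟨v, hv⟩ : ∃ v, T i j = v + 1 := ⟨T i j - 1, by omega⟩
        have hnext (i' c : ℕ) (hc : j < c) (hm : (i', c) ∈ μ) : i' < i := by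
          by_contra! hle'
          have h2 := T.row_weak hc (μ.up_left_mem hle' le_rfl hm)
          have h3 : T i c = i :=
            ih c (by omega) i (μ.up_left_mem hle' le_rfl hm)
          omega
        have hzero (l : ℕ) (hl : i ≤ l) : weightFrom T (j + 1) l = 0 := by
          rw [weightFrom, Finset.card_eq_zero, Finset.filter_eq_empty_iff]
          rintro ⟨i', c⟩ hc ⟨h1, h2⟩
          dsimp only at h1 h2
          have hm := (YoungDiagram.mem_cells _).1 hc
          have := hnext i' c h1 hm
          have := ih c (by omega) i' hm
          omega
        have h1 := h j (Nat.le_succ v)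
        dsimp only at h1
        rw [rowLen_bot, rowLen_bot, zero_add, zero_add, weightFrom_eq_ite T j, weightFrom_eq_ite T j,
          hzero _ (by omega), hzero _ (by omega), if_pos ⟨i, hi, hv⟩] at h1
        split_ifs at h1 with h2
        · obtain ⟨i', hi', hT'⟩ := h2
          have : i' < i := by
            by_contra! hle'
            have := T.col_weak hle' hi'
            omega
          have := IH i' this hi'
          omega
        · omega
    ext i j
    rw [SemistandardYoungTableau.highestWeight_apply]
    split_ifs with hi
    · exact key (μ.rowLen 0) j (by omega) i hi
    · exact T.zeros hi
  · rintro rfl j k l hkl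
    simp only [rowLen_bot, zero_add, weightFrom]
    refine Finset.card_le_card_of_injOn (fun c => (k, c.2)) ?_ ?_
    · rintro ⟨i, c⟩ hc
      rw [Finset.mem_coe, Finset.mem_filter] at hc ⊢
      simp only [YoungDiagram.mem_cells, SemistandardYoungTableau.highestWeight_apply] at hc ⊢
      obtain ⟨h1, h2, h3⟩ := hc
      rw [if_pos h1] at h3
      have := μ.up_left_mem (i1 := k) (by omega) le_rfl h1
      exact ⟨this, h2, if_pos this⟩
    · rintro ⟨i, c⟩ hc ⟨i', c'⟩ hc' heq
      rw [Finset.mem_coe, Finset.mem_filter] at hc hc'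
      simp only [YoungDiagram.mem_cells, SemistandardYoungTableau.highestWeight_apply] at hc hc'
      rw [if_pos hc.1] at hc
      rw [if_pos hc'.1] at hc'
      simp only [Prod.mk.injEq, true_and] at heq ⊢
      exact ⟨hc.2.2.trans hc'.2.2.symm, heq⟩

theorem weight_highestWeight (μ : Partition) :
    weight (SemistandardYoungTableau.highestWeight μ) = parts μ := by
  ext k
  rw [weight_apply, parts_apply, YoungDiagram.rowLen_eq_card, YoungDiagram.row]
  congr 1
  refine Finset.filter_congr fun c hc => ?_
  rw [SemistandardYoungTableau.highestWeight_apply, if_pos ((YoungDiagram.mem_cells _).1 hc)]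

/-- The bialternant formula: over the empty partition only the highest weight tableau survives the
cancellation. -/
theorem alternant_staircase_mul_schurPoly {n : ℕ} {μ : Partition} (hμ : μ.colLen 0 ≤ n + 1) :
    alternant (n + 1) (monomial (staircase (n + 1)) 1) * schurPoly (n + 1) μ =
      alternant (n + 1) (monomial (parts μ + staircase (n + 1)) 1) := by
  classical
  have h0 : parts ⊥ = 0 := by
    ext i
    simp
  have := alternant_mul_schurPoly n ⊥ μ
  rw [h0, zero_add] at this
  rw [this, Finset.sum_eq_single (SemistandardYoungTableau.highestWeight μ),
    weight_highestWeight, add_comm (parts μ)]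
  · intro T hT hne
    exact absurd (isGood_bot_iff.1 (Finset.mem_filter.1 hT).2) hne
  · intro h
    refine absurd (Finset.mem_filter.2 ⟨mem_tableaux.2 fun i c hc => ?_, isGood_bot_iff.2 rfl⟩) h
    rw [SemistandardYoungTableau.highestWeight_apply, if_pos hc]
    exact (YoungDiagram.mem_iff_lt_colLen.1 (μ.up_left_mem le_rfl (Nat.zero_le c) hc)).trans_le hμ

end SymmetricFunctions

/-! ### Products of Schur functions. -/

namespace SymmetricFunctions

open MvPolynomial

variable {μ ξ : Partition}

open Classical in
/-- The partition with parts given by `d` if `d` is antitone, the empty partition otherwise. -/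
def ofFinsupp (d : ℕ →₀ ℕ) : Partition :=
  if h : Antitone d then
    ofParts d h _ (Finsupp.notMem_support_iff.1 (Infinite.exists_notMem_finset d.support).choose_spec)
  else ⊥

theorem rowLen_ofFinsupp {d : ℕ →₀ ℕ} (h : Antitone d) (i : ℕ) : (ofFinsupp d).rowLen i = d i := by
  rw [ofFinsupp, dif_pos h, rowLen_ofParts]

theorem parts_ofFinsupp {d : ℕ →₀ ℕ} (h : Antitone d) : parts (ofFinsupp d) = d :=
  Finsupp.ext fun i => rowLen_ofFinsupp h i

/-- The partition obtained by adding the entries of `T` to `ξ`. -/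
def addWeight (ξ : Partition) (T : SemistandardYoungTableau μ) : Partition :=
  ofFinsupp (parts ξ + weight T)

theorem IsGood.antitone {T : SemistandardYoungTableau μ} (h : IsGood ξ T) :
    Antitone ⇑(parts ξ + weight T) := by
  have := h 0
  simp only [weightFrom_zero] at this
  exact this

theorem IsGood.rowLen_addWeight {T : SemistandardYoungTableau μ} (h : IsGood ξ T) (i : ℕ) :
    (addWeight ξ T).rowLen i = ξ.rowLen i + weight T i :=
  rowLen_ofFinsupp h.antitone i

theorem IsGood.parts_addWeight {T : SemistandardYoungTableau μ} (h : IsGood ξ T) :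
    parts (addWeight ξ T) = parts ξ + weight T :=
  parts_ofFinsupp h.antitone

theorem degree_weight (T : SemistandardYoungTableau μ) : (weight T).degree = μ.card := by
  rw [weight, map_sum]
  simp [Finsupp.degree_single, YoungDiagram.card]

theorem IsGood.card_addWeight {T : SemistandardYoungTableau μ} (h : IsGood ξ T) :
    (addWeight ξ T).card = ξ.card + μ.card := by
  rw [← degree_parts, h.parts_addWeight, map_add, degree_parts, degree_weight]

theorem weight_entry_ne_zero (T : SemistandardYoungTableau μ) {i c : ℕ} (hc : (i, c) ∈ μ) :
    weight T (T i c) ≠ 0 := by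
  rw [weight_apply]
  exact Finset.card_ne_zero_of_mem (a := (i, c))
    (Finset.mem_filter.2 ⟨(YoungDiagram.mem_cells _).2 hc, rfl⟩)

/-- An entry v makes row v of the resulting partition nonempty, so v is less than its size. Hence
the set of good tableaux is independent of n once n is large. -/
theorem IsGood.mem_tableaux {T : SemistandardYoungTableau μ} (h : IsGood ξ T) {n : ℕ}
    (hn : ξ.card + μ.card ≤ n) : T ∈ tableaux n μ := by
  refine SymmetricFunctions.mem_tableaux.2 fun i c hc => ?_
  have h1 := h.rowLen_addWeight (T i c)
  have h2 := weight_entry_ne_zero T hc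
  have h3 : (T i c, 0) ∈ addWeight ξ T := YoungDiagram.mem_iff_lt_rowLen.2 (by omega)
  have h4 := (add_lt_card _ h3).1
  rw [h.card_addWeight] at h4
  omega

theorem colLen_zero_le_card (μ : Partition) : μ.colLen 0 ≤ μ.card := by
  rw [YoungDiagram.colLen_eq_card]
  exact Finset.card_le_card (Finset.filter_subset _ _)

open Classical in
/-- The good tableaux of shape `μ` over `ξ`, which index the terms of the product of the Schur
functions of `ξ` and `μ`. -/
def goodTableaux (ξ μ : Partition) : Finset (SemistandardYoungTableau μ) :=
  (tableaux (ξ.card + μ.card) μ).filter (IsGood ξ)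

theorem mem_goodTableaux {T : SemistandardYoungTableau μ} :
    T ∈ goodTableaux ξ μ ↔ IsGood ξ T := by
  classical
  rw [goodTableaux, Finset.mem_filter]
  exact ⟨fun h => h.2, fun h => ⟨h.mem_tableaux le_rfl, h⟩⟩

/-- After multiplication by the staircase alternant, a nonzerodivisor, both sides become the same
sum of alternants. -/
theorem schurPoly_mul {n : ℕ} (hn : ξ.card + μ.card ≤ n + 1) :
    schurPoly (n + 1) ξ * schurPoly (n + 1) μ =
      ∑ T ∈ goodTableaux ξ μ, schurPoly (n + 1) (addWeight ξ T) := by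
  classical
  refine mul_left_cancel₀ (alternant_staircase_ne_zero (n + 1)) ?_
  have hξ := colLen_zero_le_card ξ
  rw [← mul_assoc, alternant_staircase_mul_schurPoly (by omega), alternant_mul_schurPoly,
    Finset.mul_sum]
  refine Finset.sum_congr ?_ fun T hT => ?_
  · ext T
    rw [Finset.mem_filter, mem_goodTableaux]
    exact ⟨fun h => h.2, fun h => ⟨h.mem_tableaux hn, h⟩⟩
  · have h := mem_goodTableaux.1 hT
    have hc := colLen_zero_le_card (addWeight ξ T)
    rw [h.card_addWeight] at hc
    rw [alternant_staircase_mul_schurPoly (by omega), h.parts_addWeight, add_right_comm]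

theorem coeff_schurPoly {n : ℕ} {d : ℕ →₀ ℕ} (hd : ∀ i, n ≤ i → d i = 0) :
    coeff d (schurPoly n μ) = MvPowerSeries.coeff d (schur μ) := by
  classical
  change _ = schur μ d
  rw [schurPoly, coeff_sum, schur]
  simp only [coeff_monomial]
  rw [Finset.sum_boole]
  congr 1
  rw [← Nat.card_eq_finsetCard]
  refine Nat.card_congr (Equiv.subtypeEquivRight fun T => ?_)
  rw [Finset.mem_filter]
  constructor
  · rintro ⟨_, rfl⟩ k
    exact (weight_apply T k).symm
  · intro h
    have hw : weight T = d := Finsupp.ext fun k => (weight_apply T k).trans (h k)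
    refine ⟨mem_tableaux.2 fun i c hc => ?_, hw⟩
    by_contra! hlt
    exact weight_entry_ne_zero T hc (hw ▸ hd _ hlt)

/-- Each coefficient is already visible in finitely many variables, enough for its exponent and for
`schurPoly_mul`. -/
theorem schur_mul (ξ μ : Partition) :
    schur ξ * schur μ = ∑ T ∈ goodTableaux ξ μ, schur (addWeight ξ T) := by
  classical
  ext d
  obtain ⟨n, hn, hd⟩ : ∃ n, ξ.card + μ.card ≤ n + 1 ∧ ∀ i, n + 1 ≤ i → d i = 0 := by
    refine ⟨max (ξ.card + μ.card) (d.support.sup id), by omega, fun i hi => ?_⟩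
    by_contra h
    have := Finset.le_sup (f := id) (Finsupp.mem_support_iff.2 h)
    simp only [id] at this
    omega
  have := congrArg (coeff d) (schurPoly_mul hn)
  rw [coeff_sum, coeff_mul] at this
  rw [map_sum, MvPowerSeries.coeff_mul]
  refine Eq.trans (Finset.sum_congr rfl fun p hp => ?_) (this.trans
    (Finset.sum_congr rfl fun T _ => coeff_schurPoly hd))
  rw [Finset.HasAntidiagonal.mem_antidiagonal] at hp
  have hp' (i : ℕ) (hi : n + 1 ≤ i) : p.1 i = 0 ∧ p.2 i = 0 := by
    have := hd i hi
    rw [← hp, Finsupp.add_apply] at this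
    omega
  rw [coeff_schurPoly fun i hi => (hp' i hi).1, coeff_schurPoly fun i hi => (hp' i hi).2]

theorem LambdaSch.s_mul (ξ μ : Partition) :
    LambdaSch.s ξ * LambdaSch.s μ = ∑ T ∈ goodTableaux ξ μ, LambdaSch.s (addWeight ξ T) := by
  apply Subtype.ext
  change schur ξ * schur μ = LambdaSch.subtype _
  rw [schur_mul, map_sum]
  rfl

theorem LambdaSch.s_bot : LambdaSch.s ⊥ = 1 := by
  classical
  apply Subtype.ext
  change schur ⊥ = 1
  ext d
  rw [MvPowerSeries.coeff_one]
  change (Nat.card (TableauOfWeight ⊥ d) : ℤ) = _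
  have hs : Subsingleton (TableauOfWeight ⊥ d) := ⟨fun T T' => Subtype.ext (by
    ext i j
    rw [T.1.zeros (YoungDiagram.notMem_bot _), T'.1.zeros (YoungDiagram.notMem_bot _)])⟩
  split_ifs with h
  · subst h
    have : Nonempty (TableauOfWeight ⊥ 0) :=
      ⟨⟨SemistandardYoungTableau.highestWeight ⊥, fun k => by simp⟩⟩
    rw [Nat.card_of_subsingleton this.some, Nat.cast_one]
  · have : IsEmpty (TableauOfWeight ⊥ d) := ⟨fun T => h (Finsupp.ext fun k => by
      rw [← T.2 k]
      simp)⟩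
    rw [Nat.card_of_isEmpty, Nat.cast_zero]

/-- The tableau with one cell and entry `k`. -/
def singleCell (k : ℕ) : SemistandardYoungTableau (rect 1 1) where
  entry i j := if (i, j) ∈ rect 1 1 then k else 0
  row_weak' hj h := by
    rw [YoungDiagram.mem_iff_lt_rowLen, rowLen_rect] at h
    split_ifs at h <;> omega
  col_strict' hi h := by
    rw [YoungDiagram.mem_iff_lt_rowLen, rowLen_rect] at h
    split_ifs at h <;> omega
  zeros' h := if_neg h

theorem cells_rect_one : (rect 1 1).cells = {(0, 0)} := by
  ext ⟨i, j⟩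
  rw [YoungDiagram.mem_cells, YoungDiagram.mem_iff_lt_rowLen, rowLen_rect]
  simp only [Finset.mem_singleton, Prod.mk.injEq]
  split_ifs <;> omega

theorem singleCell_apply (k : ℕ) : singleCell k 0 0 = k := by
  change (if (0, 0) ∈ rect 1 1 then k else 0) = k
  rw [if_pos (by rw [YoungDiagram.mem_iff_lt_rowLen, rowLen_rect]; simp)]

theorem weight_singleCell (k : ℕ) : weight (singleCell k) = Finsupp.single k 1 := by
  rw [weight, cells_rect_one, Finset.sum_singleton, singleCell_apply]

theorem isGood_singleCell {k : ℕ} (h : Antitone (parts ξ + Finsupp.single k 1 : ℕ →₀ ℕ)) :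
    IsGood ξ (singleCell k) := by
  intro j
  rcases Nat.eq_zero_or_pos j with rfl | hj
  · simp only [weightFrom_zero, weight_singleCell]
    exact h
  · have h0 (l : ℕ) : weightFrom (singleCell k) j l = 0 :=
      weightFrom_eq_zero _ (by rw [rowLen_rect, if_pos zero_lt_one]; exact hj) l
    simp only [h0, add_zero]
    exact fun a b hab => ξ.rowLen_anti a b hab

/-- In a good rectangular tableau over a partition with at most `m` parts whose bottom row has
entries at least `m`, every column contains `m`. -/
theorem IsGood.le_weight {x y m : ℕ} {T : SemistandardYoungTableau (rect (x + 1) y)}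
    (h : IsGood ξ T) (hξ : ∀ k, m ≤ k → ξ.rowLen k = 0) (hm : ∀ j < y, m ≤ T x j) :
    y ≤ weight T m := by
  classical
  have hmem (i j : ℕ) : (i, j) ∈ rect (x + 1) y ↔ i < x + 1 ∧ j < y := by
    rw [YoungDiagram.mem_iff_lt_rowLen, rowLen_rect]
    split_ifs with hi <;> simp [hi]
  have hfull (k : ℕ) (t : ℕ) : ∀ j, y = j + t →
      (∀ j', j ≤ j' → j' < y → ∃ i, (i, j') ∈ rect (x + 1) y ∧ T i j' = k) →
      weightFrom T j k = t := by
    induction t with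
    | zero =>
      intro j hj _
      exact weightFrom_eq_zero T (by rw [rowLen_rect]; simp; omega) k
    | succ t ih =>
      intro j hj hk
      rw [weightFrom_eq_ite, ih (j + 1) (by omega) fun j' hj' => hk j' (by omega),
        if_pos (hk j le_rfl (by omega))]
  -- Induction on columns from the right: each contains all values from m up to its bottom entry.
  have key (t : ℕ) : ∀ j, j < y → y ≤ j + t → ∀ k, m ≤ k → k ≤ T x j →
      ∃ i, (i, j) ∈ rect (x + 1) y ∧ T i j = k := by
    induction t with
    | zero =>
      intro j h1 h2
      omega
    | succ t ih =>
      intro j hj hjt k hmk hkT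
      by_contra hno
      -- Take the least v = u + 1 above the missing k: the column contains u + 1 but not u. Further
      -- right both occur in every column, and `ξ` has no rows there, so goodness fails at column j.
      have hex : ∃ v, k < v ∧ ∃ i, (i, j) ∈ rect (x + 1) y ∧ T i j = v := by
        have hx : (x, j) ∈ rect (x + 1) y := (hmem x j).2 ⟨Nat.lt_succ_self x, hj⟩
        refine ⟨T x j, lt_of_le_of_ne hkT fun heq => hno ⟨x, hx, heq.symm⟩, x, hx, rfl⟩
      obtain ⟨hv1, i, hi, hv2⟩ := Nat.find_spec hex
      obtain ⟨u, hu⟩ : ∃ u, Nat.find hex = u + 1 := ⟨Nat.find hex - 1, by omega⟩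
      have hu' : ¬ ∃ i, (i, j) ∈ rect (x + 1) y ∧ T i j = u := by
        intro h'
        rcases Nat.lt_or_ge k u with hlt | hge
        · exact Nat.find_min hex (m := u) (by omega) ⟨hlt, h'⟩
        · obtain rfl : u = k := by omega
          exact hno h'
      have hright (l : ℕ) (hl : m ≤ l) (hlT : l ≤ T x j) :
          weightFrom T (j + 1) l = y - (j + 1) := by
        refine hfull l _ (j + 1) (by omega) fun j' h1 h2 => ih j' h2 (by omega) l hl (hlT.trans ?_)
        exact T.row_weak_of_le (by omega) ((hmem x j').2 ⟨Nat.lt_succ_self x, h2⟩)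
      have hvT : u + 1 ≤ T x j := by
        rw [← hu, ← hv2]
        exact T.col_weak (by have := ((hmem i j).1 hi).1; omega)
          ((hmem x j).2 ⟨Nat.lt_succ_self x, hj⟩)
      have hg := h j (show u ≤ u + 1 by omega)
      dsimp only at hg
      rw [hξ u (by omega), hξ (u + 1) (by omega), weightFrom_eq_ite T j, weightFrom_eq_ite T j,
        hright u (by omega) (by omega), hright (u + 1) (by omega) hvT, if_neg hu',
        if_pos ⟨i, hi, by omega⟩] at hg
      omega
  rw [← weightFrom_zero, hfull m y 0 (by omega)]
  intro j _ hj
  exact key y j hj (by omega) m le_rfl (hm j hj)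

/-! ### Vanishing of Schur Witt vectors. -/

namespace IsZerosumfreeDomain

variable {A : Type*} [CommSemiring A]

/-- The product of the values at two Schur functions is nonzero if and only if the value is
nonzero at some term of their product. -/
theorem map_s_mul_ne_zero_iff (hA : IsZerosumfreeDomain A) (a : SchurWitt A) (ξ μ : Partition) :
    (a (LambdaSch.s ξ) ≠ 0 ∧ a (LambdaSch.s μ) ≠ 0) ↔
      ∃ T : SemistandardYoungTableau μ, IsGood ξ T ∧ a (LambdaSch.s (addWeight ξ T)) ≠ 0 := by
  rw [← hA.mul_ne_zero_iff, ← map_mul, LambdaSch.s_mul, map_sum, hA.sum_ne_zero_iff]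
  simp only [mem_goodTableaux]

/-- Grow `μ` to `ν` one cell at a time, each being a constituent of a product with the one-cell
Schur function. The first row where `μ` is shorter can take a cell, since the rows above agree with
those of `ν`. -/
theorem map_s_ne_zero_of_le (hA : IsZerosumfreeDomain A) (a : SchurWitt A) {μ ν : Partition}
    (hle : μ ≤ ν) (hν : a (LambdaSch.s ν) ≠ 0) : a (LambdaSch.s μ) ≠ 0 := by
  classical
  induction hm : ν.card - μ.card generalizing μ with
  | zero =>
    have : μ.cells = ν.cells :=
      Finset.eq_of_subset_of_card_le (YoungDiagram.cells_subset_iff.2 hle) (by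
        change ν.card ≤ μ.card
        omega)
    rwa [YoungDiagram.ext this]
  | succ m ih =>
    have hex : ∃ i, μ.rowLen i < ν.rowLen i := by
      by_contra! h
      have : μ = ν := le_antisymm hle (le_iff_rowLen.2 h)
      rw [this] at hm
      omega
    have hi := Nat.find_spec hex
    have hlt (k : ℕ) (hk : k < Nat.find hex) : ν.rowLen k ≤ μ.rowLen k :=
      not_lt.1 (Nat.find_min hex hk)
    generalize Nat.find hex = i at hi hlt
    have hanti : Antitone (parts μ + Finsupp.single i 1 : ℕ →₀ ℕ) := by
      intro k l hkl
      simp only [Finsupp.add_apply, parts_apply, Finsupp.single_apply]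
      have h1 := μ.rowLen_anti k l hkl
      have h2 := ν.rowLen_anti k l hkl
      split_ifs with h3 h4 h4
      · omega
      · subst h3
        have := hlt k (by omega)
        omega
      · omega
      · omega
    have hgood := isGood_singleCell hanti
    refine ((hA.map_s_mul_ne_zero_iff a μ (rect 1 1)).2
      ⟨singleCell i, hgood, ih (le_iff_rowLen.2 fun k => ?_) ?_⟩).1
    · rw [hgood.rowLen_addWeight, weight_singleCell, Finsupp.single_apply]
      have := le_iff_rowLen.1 hle k
      split_ifs with h
      · subst h
        omega
      · omega
    · rw [hgood.card_addWeight]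
      have : (rect 1 1).card = 1 := by
        rw [YoungDiagram.card, cells_rect_one, Finset.card_singleton]
      omega

theorem schurWitt_existsUnique (hA : IsZerosumfreeDomain A) (a : SchurWitt A)
    (h : ∃ μ, a (LambdaSch.s μ) = 0) :
    ∃! p : ℕ × ℕ, ∀ μ, a (LambdaSch.s μ) = 0 ↔ p.2 + 1 ≤ μ.rowLen p.1 := by
  have := existsUnique_rect (fun μ => a (LambdaSch.s μ) ≠ 0) ?_
    (fun μ ν hle hν => hA.map_s_ne_zero_of_le a hle hν) ?_ (by simpa only [not_not] using h)
  · simpa only [not_not] using this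
  · have := hA.nontrivial
    rw [LambdaSch.s_bot, map_one]
    exact one_ne_zero
  · intro x n k y hyn h1 h2 h3
    obtain ⟨T, hT, hν⟩ := (hA.map_s_mul_ne_zero_iff a _ _).1 ⟨h1, h2⟩
    refine hA.map_s_ne_zero_of_le a (le_iff_rowLen.2 fun i => ?_) hν
    have hx : (addWeight (hook x n k y hyn.le) T).rowLen x ≤ y := by
      by_contra! h
      exact h3 (hA.map_s_ne_zero_of_le a ((rect_le_iff _ _ _).2 h) hν)
    have hm : y ≤ weight T (x + k) := by
      refine hT.le_weight (fun l hl => ?_) fun j hj => ?_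
      · rw [rowLen_hook, if_neg (by omega), if_neg (by omega)]
      · have hc : (x, j) ∈ rect (x + 1) y := by
          rw [YoungDiagram.mem_iff_lt_rowLen, rowLen_rect, if_pos (Nat.lt_succ_self x)]
          exact hj
        have h1 := le_entry T hc
        have h2 := weight_entry_ne_zero T hc
        -- A bottom entry before x + k would lengthen a leg row of the hook beyond y, and with it
        -- row x of the sum, against `hx`.
        by_contra! hlt
        have h3 := (addWeight (hook x n k y hyn.le) T).rowLen_anti _ _ h1
        rw [hT.rowLen_addWeight (T x j), rowLen_hook, if_neg (by omega), if_pos hlt] at h3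
        omega
    rw [hT.rowLen_addWeight, rowLen_hook, rowLen_hook]
    split_ifs with h4 h5 h6 h7
    · omega
    · omega
    · obtain rfl : i = x + k := by omega
      omega
    all_goals omega

end IsZerosumfreeDomain

end SymmetricFunctions

end

theorem mainTheorem10 {A : Type*} [CommSemiring A]
    (hA : SymmetricFunctions.IsZerosumfreeDomain A) :
    (∀ a : SymmetricFunctions.BigWitt A,
      (∃ μ : SymmetricFunctions.Partition, a (SymmetricFunctions.LambdaNat.m μ) = 0) →
        ∃! p : ℕ × ℕ, ∀ μ : SymmetricFunctions.Partition,
          a (SymmetricFunctions.LambdaNat.m μ) = 0 ↔ p.2 + 1 ≤ μ.rowLen p.1) ∧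
    (∀ a : SymmetricFunctions.SchurWitt A,
      (∃ μ : SymmetricFunctions.Partition, a (SymmetricFunctions.LambdaSch.s μ) = 0) →
        ∃! p : ℕ × ℕ, ∀ μ : SymmetricFunctions.Partition,
          a (SymmetricFunctions.LambdaSch.s μ) = 0 ↔ p.2 + 1 ≤ μ.rowLen p.1) :=
  ⟨hA.bigWitt_existsUnique, hA.schurWitt_existsUnique⟩
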